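/- **Setting.** Let $m\ge 2$ be the number of candidates and $\Delta^m=\{x\in\mathbb R_{\ge 0}^m:\sum_{j}x_j=1\}$. An instance with $n\geq 1$ agents is a tuple $\mathcal I=(s_1,\dots,s_n)\in(\Delta^m)^n$, where $s_i=(s_{i,1},\dots,s_{i,m})$ is the ideal distribution of agent $i$; the disutility of agent $i$ from $x\in\Delta^m$ is $d_i(x)=\sum_{j=1}^m|s_{i,j}-x_j|$. An aggregation rule $F$ assigns to every instance (with any number of agents) an outcome in $\Delta^m$. $F$ is *strategyproof for $n$ agents* if for all $n$-agent instances $\mathcal I,\mathcal I'$ that differ at most in the ideal distribution of one agent $i$, we have $d_i(F(\mathcal I))\le d_i(F(\mathcal I'))$, where $d_i$ is taken with respect to $\mathcal I$; $F$ is *strategyproof* if this holds for all $n$. $F$ satisfies *participation* if for every instance $\mathcal I$ and every agent $i$ such that at least one other agent remains, $d_i(F(\mathcal I))\le d_i(F(\mathcal I'))$, where $\mathcal I'$ results from $\mathcal I$ by removing agent $i$. **Rules.** - Avg, Max, Min, Med, Geo: $F(\mathcal I)_j=f(s_{1,j},\dots,s_{n,j})/\sum_{k}f(s_{1,k},\dots,s_{n,k})$,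 where $f$ is respectively the average, maximum, minimum, median (the average of the two middle entries if $n$ is even), and geometric mean; if $f(s_{1,j},\dots,s_{n,j})=0$ for all $j$, the outcome is $(\frac1m,\dots,\frac1m)$. - Util: the outcome that, among all maximizers of $-\sum_i d_i(x)$ over $\Delta^m$, minimizes $\sum_j(x_j-\frac1m)^2$. - Egal: any rule that always chooses an outcome $x\in\Delta^m$ whose vector of agents' disutilities, sorted in non-increasing order, is lexicographically smallest; ties that remain may be broken arbitrarily. - IM (independent markets): for $n\ge 2$ let $f_k(t)=\min(kt,1)$ for $0\le t<1$ and $f_k(1)=1$, for $k=0,\dots,n$. Let $t^*$ be the smallest $t\in[0,1]$ with $\sum_{j}\mathrm{med}(s_{1,j},\dots,s_{n,j},f_0(t),\dots,f_n(t))=1$; the outcome is $x_j=\mathrm{med}(s_{1,j},\dots,s_{n,j},f_0(t^*),\dots,f_n(t^*))$. For $n=1$ the outcome is $s_1$. **Theorem.** For every $m\ge 2$: 1. IM and Util are strategyproof and satisfy participation. 2. Avg, Max, Min, Geo, and (for every way of breaking the remaining ties) Egal are not strategyproof for $n$ agents for any $n\ge 2$, but they satisfy participation. 3. For every $n\ge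 2$, Med is strategyproof for $n$ agents if and only if $m=2$ and $n$ is odd. Moreover, Med satisfies participation if $m=2$, and if $m\ge 3$ it violates participation (even for some instance in which at least two agents remain after the removal). -/

import Mathlib

open Set Topology

noncomputable section

namespace Portioning

/-! ### Model -/

/-- The distributions over `m` candidates. -/
abbrev Simplex (m : ℕ) : Type := stdSimplex ℝ (Fin m)

/-- An instance: every one of the `n` agents reports her ideal distribution over the
`m` candidates. -/
abbrev Profile (n m : ℕ) : Type := Fin n → Simplex m

/-- An aggregation rule for `m` candidates (and an arbitrary number of agents). -/
abbrev AggregationRule (m : ℕ) : Type := ∀ n : ℕ, Profile n m → Simplex m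

/-- The disutility of an agent with ideal distribution `s` from the outcome `x`:
the `ℓ₁` distance. -/
def disutility {m : ℕ} (s x : Simplex m) : ℝ := ∑ j, |s j - x j|

/-! ### Incentive properties -/

/-- Strategyproofness on the instances with exactly `n` agents. -/
def StrategyproofFor {m : ℕ} (F : AggregationRule m) (n : ℕ) : Prop :=
  ∀ (I I' : Profile n m) (i : Fin n), (∀ i', i' ≠ i → I i' = I' i') →
    disutility (I i) (F n I) ≤ disutility (I i) (F n I')

/-- Strategyproofness for every number of agents. -/
def Strategyproof {m : ℕ} (F : AggregationRule m) : Prop :=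
  ∀ n : ℕ, 1 ≤ n → StrategyproofFor F n

/-- Participation when one of `n + 1` agents abstains: `fun k => I (i.succAbove k)` is the
instance obtained from `I` by removing agent `i`. -/
def ParticipationFor {m : ℕ} (F : AggregationRule m) (n : ℕ) : Prop :=
  ∀ (I : Profile (n + 1) m) (i : Fin (n + 1)),
    disutility (I i) (F (n + 1) I) ≤ disutility (I i) (F n fun k => I (i.succAbove k))

/-- Participation for every number of (remaining) agents. -/
def Participation {m : ℕ} (F : AggregationRule m) : Prop :=
  ∀ n : ℕ, 1 ≤ n → ParticipationFor F n

/-! ### Order statistics and medians -/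

/-- The entry with index `k` (counted from `0`) in the list of the elements of `M` sorted in
non-increasing order. -/
def nthLargest (M : Multiset ℝ) (k : ℕ) : ℝ := (M.sort (· ≥ ·)).getD k 0

/-- The median of a nonempty finite collection of reals; it is the average of the two middle
entries if their number is even. -/
def median (M : Multiset ℝ) : ℝ :=
  (nthLargest M ((M.card - 1) / 2) + nthLargest M (M.card / 2)) / 2

theorem nthLargest_iff (p : ℝ → Prop) [DecidablePred p] (hp : ∀ a b, a ≤ b → p a → p b)
    (M : Multiset ℝ) (k : ℕ) (hk : k < M.card) :
    p (nthLargest M k) ↔ k < M.countP p := by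
  have hs : (M.sort (· ≥ ·)).Pairwise (· ≥ ·) := Multiset.pairwise_sort M (· ≥ ·)
  have hl : (M.sort (· ≥ ·)).length = M.card := Multiset.length_sort (· ≥ ·)
  have hc : M.countP p = (M.sort (· ≥ ·)).countP p := by
    conv_lhs => rw [← Multiset.sort_eq M (· ≥ ·)]
    exact Multiset.coe_countP ..
  unfold nthLargest
  rw [hc]
  rw [← hl] at hk
  generalize M.sort (· ≥ ·) = l at hs hk
  clear hc hl
  induction l generalizing k with
  | nil => simp at hk
  | cons a l ih =>
    rw [List.pairwise_cons] at hs
    have h0 : ¬ p a → l.countP (fun b => decide (p b)) = 0 := by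
      intro ha
      rw [List.countP_eq_zero]
      intro b hb
      simpa using fun hpb => ha (hp b a (hs.1 b hb) hpb)
    cases k with
    | zero =>
      by_cases ha : p a
      · simp [ha]
      · simp [ha, h0 ha]
    | succ k =>
      have := ih k hs.2 (by simpa using hk)
      rw [List.getD_cons_succ]
      refine this.trans ?_
      by_cases ha : p a
      · simp [ha]
      · simp [ha, h0 ha]

theorem nthLargest_nonneg {M : Multiset ℝ} (hM : ∀ a ∈ M, 0 ≤ a) (k : ℕ) :
    0 ≤ nthLargest M k := by
  unfold nthLargest
  rcases lt_or_ge k (M.sort (· ≥ ·)).length with h | h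
  · rw [List.getD_eq_getElem _ _ h]
    exact hM _ (by rw [← Multiset.mem_sort (s := M) (· ≥ ·)]; exact List.getElem_mem h)
  · rw [List.getD_eq_default _ _ h]

theorem median_nonneg {M : Multiset ℝ} (hM : ∀ a ∈ M, 0 ≤ a) : 0 ≤ median M := by
  have h1 := nthLargest_nonneg hM ((M.card - 1) / 2)
  have h2 := nthLargest_nonneg hM (M.card / 2)
  unfold median
  linarith

theorem lt_countP_map_iff {X : Type*} (S : Multiset (X → ℝ)) (p : ℝ → Prop) [DecidablePred p]
    (k : ℕ) (x : X) :
    k < (S.map fun g => g x).countP p ↔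
      ∃ T ∈ {T | T ∈ S.powersetCard (k + 1)}, ∀ g ∈ {g | g ∈ T}, p (g x) := by
  classical
  rw [Multiset.countP_map]
  constructor
  · intro h
    have hne : 0 < ((S.filter fun g => p (g x)).powersetCard (k + 1)).card := by
      rw [Multiset.card_powersetCard]
      exact Nat.choose_pos (Nat.succ_le_of_lt h)
    obtain ⟨T, hT'⟩ := Multiset.card_pos_iff_exists_mem.1 hne
    obtain ⟨hT, hc⟩ := Multiset.mem_powersetCard.1 hT'
    refine ⟨T, ?_, ?_⟩
    · exact Multiset.mem_powersetCard.2 ⟨hT.trans (Multiset.filter_le _ _), hc⟩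
    · intro g hg
      exact (Multiset.mem_filter.1 (Multiset.mem_of_le hT hg)).2
  · rintro ⟨T, hT, hp⟩
    obtain ⟨hTS, hc⟩ := Multiset.mem_powersetCard.1 hT
    have : T ≤ S.filter fun g => p (g x) := Multiset.le_filter.2 ⟨hTS, fun g hg => hp g hg⟩
    have := Multiset.card_le_card this
    omega

theorem continuous_nthLargest {X : Type*} [TopologicalSpace X] (S : Multiset (X → ℝ))
    (hS : ∀ g ∈ S, Continuous g) (k : ℕ) :
    Continuous fun x => nthLargest (S.map fun g => g x) k := by
  classical
  rcases le_or_gt S.card k with hk | hk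
  · have : (fun x => nthLargest (S.map fun g => g x) k) = fun _ => 0 := by
      funext x
      exact List.getD_eq_default _ _ (by simpa using hk)
    rw [this]
    exact continuous_const
  have hfin : {T | T ∈ S.powersetCard (k + 1)}.Finite :=
    (Multiset.finite_toSet (S.powersetCard (k + 1)))
  have hfin' : ∀ T : Multiset (X → ℝ), {g | g ∈ T}.Finite := fun T => Multiset.finite_toSet T
  have hmem : ∀ T ∈ {T | T ∈ S.powersetCard (k + 1)}, ∀ g ∈ {g | g ∈ T}, Continuous g :=
    fun T hT g hg => hS g (Multiset.mem_of_le (Multiset.mem_powersetCard.1 hT).1 hg)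
  rw [continuous_iff_lower_upperSemicontinuous]
  constructor
  · rw [lowerSemicontinuous_iff_isOpen_preimage]
    intro c
    have : (fun x => nthLargest (S.map fun g => g x) k) ⁻¹' Ioi c =
        ⋃ T ∈ {T | T ∈ S.powersetCard (k + 1)}, ⋂ g ∈ {g | g ∈ T}, g ⁻¹' Ioi c := by
      ext x
      simp only [mem_preimage, mem_Ioi, mem_iUnion₂, mem_iInter₂, exists_prop]
      rw [nthLargest_iff (fun a => c < a) (fun a b hab h => h.trans_le hab) _ _ (by simpa using hk),
        lt_countP_map_iff]
    rw [this]
    exact isOpen_biUnion fun T hT => (hfin' T).isOpen_biInter fun g hg =>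
      isOpen_Ioi.preimage (hmem T hT g hg)
  · rw [upperSemicontinuous_iff_isClosed_preimage]
    intro c
    have : (fun x => nthLargest (S.map fun g => g x) k) ⁻¹' Ici c =
        ⋃ T ∈ {T | T ∈ S.powersetCard (k + 1)}, ⋂ g ∈ {g | g ∈ T}, g ⁻¹' Ici c := by
      ext x
      simp only [mem_preimage, mem_Ici, mem_iUnion₂, mem_iInter₂, exists_prop]
      rw [nthLargest_iff (fun a => c ≤ a) (fun a b hab h => h.trans hab) _ _ (by simpa using hk),
        lt_countP_map_iff]
    rw [this]
    exact hfin.isClosed_biUnion fun T hT => isClosed_biInter fun g hg =>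
      isClosed_Ici.preimage (hmem T hT g hg)

/-! ### Coordinate-wise rules -/

/-- The uniform distribution. -/
def uniform (m : ℕ) [NeZero m] : Simplex m :=
  ⟨fun _ => 1 / (m : ℝ), fun _ => by positivity, by
    have : (m : ℝ) ≠ 0 := Nat.cast_ne_zero.2 (NeZero.ne m)
    simp [this]⟩

/-- The coordinate-wise rule that aggregates the scores of each candidate by `f` and then
normalizes; if all aggregated scores are `0`, the outcome is the uniform distribution. -/
def coordinateWise {m : ℕ} [NeZero m] (f : ∀ n : ℕ, (Fin n → ℝ) → ℝ)
    (hf : ∀ n v, (∀ i, 0 ≤ v i) → 0 ≤ f n v) : AggregationRule m := fun n I =>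
  open Classical in
  if h : ∀ j, f n (fun i => I i j) = 0 then uniform m
  else
    ⟨fun j => f n (fun i => I i j) / ∑ k, f n (fun i => I i k),
      fun j => div_nonneg (hf _ _ fun i => (I i).2.1 j)
        (Finset.sum_nonneg fun k _ => hf _ _ fun i => (I i).2.1 k), by
      rw [← Finset.sum_div]
      refine div_self fun h0 => h fun j => ?_
      exact (Finset.sum_eq_zero_iff_of_nonneg
        fun k _ => hf _ _ fun i => (I i).2.1 k).1 h0 j (Finset.mem_univ j)⟩

/-- The average rule. -/
def avg (m : ℕ) [NeZero m] : AggregationRule m :=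
  coordinateWise (fun n v => (∑ i, v i) / n)
    fun _ _ hv => div_nonneg (Finset.sum_nonneg fun i _ => hv i) (Nat.cast_nonneg _)

/-- The maximum rule. -/
def maxRule (m : ℕ) [NeZero m] : AggregationRule m :=
  coordinateWise (fun _ v => ⨆ i, v i) fun _ _ hv => Real.iSup_nonneg hv

/-- The minimum rule. -/
def minRule (m : ℕ) [NeZero m] : AggregationRule m :=
  coordinateWise (fun _ v => ⨅ i, v i) fun _ _ hv => Real.iInf_nonneg hv

/-- The median rule. -/
def med (m : ℕ) [NeZero m] : AggregationRule m :=
  coordinateWise (fun _ v => median (Finset.univ.val.map v)) fun _ v hv =>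
    median_nonneg fun a ha => by
      obtain ⟨i, -, rfl⟩ := Multiset.mem_map.1 ha
      exact hv i

/-- The geometric mean rule. -/
def geo (m : ℕ) [NeZero m] : AggregationRule m :=
  coordinateWise (fun n v => (∏ i, v i) ^ (1 / (n : ℝ)))
    fun _ _ hv => Real.rpow_nonneg (Finset.prod_nonneg fun i _ => hv i) _

/-! ### Welfare-based rules -/

theorem continuous_apply_simplex {m : ℕ} (j : Fin m) : Continuous fun x : Simplex m => x j :=
  (continuous_apply j).comp continuous_subtype_val

theorem continuous_disutility {m : ℕ} (s : Simplex m) : Continuous (disutility s) := by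
  unfold disutility
  exact continuous_finsetSum _ fun j _ =>
    (continuous_const.sub (continuous_apply_simplex j)).abs

/-- The utilitarian welfare of the outcome `x`. -/
def utilitarianWelfare {n m : ℕ} (I : Profile n m) (x : Simplex m) : ℝ :=
  -∑ i, disutility (I i) x

/-- `x` maximizes the utilitarian welfare. -/
def IsUtilitarianOptimal {n m : ℕ} (I : Profile n m) (x : Simplex m) : Prop :=
  ∀ y, utilitarianWelfare I y ≤ utilitarianWelfare I x

/-- The square of the `ℓ₂` distance to the uniform distribution. -/
def sqDistUniform {m : ℕ} (x : Simplex m) : ℝ := ∑ j, (x j - 1 / (m : ℝ)) ^ 2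

/-- `x` maximizes the utilitarian welfare and, among all outcomes that do so, is closest to the
uniform distribution. -/
def IsUtilOutcome {n m : ℕ} (I : Profile n m) (x : Simplex m) : Prop :=
  IsUtilitarianOptimal I x ∧ ∀ y, IsUtilitarianOptimal I y → sqDistUniform x ≤ sqDistUniform y

theorem exists_isUtilOutcome {n m : ℕ} [NeZero m] (I : Profile n m) :
    ∃ x, IsUtilOutcome I x := by
  have hW : Continuous (utilitarianWelfare I) := by
    unfold utilitarianWelfare
    exact (continuous_finsetSum _ fun i _ => continuous_disutility (I i)).neg
  have hD : Continuous (sqDistUniform (m := m)) := by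
    unfold sqDistUniform
    exact continuous_finsetSum _ fun j _ => ((continuous_apply_simplex j).sub continuous_const).pow 2
  obtain ⟨x₀, -, hx₀⟩ :=
    isCompact_univ.exists_isMaxOn ⟨uniform m, mem_univ _⟩ hW.continuousOn
  have hcl : IsClosed {x | IsUtilitarianOptimal I x} := by
    simp only [IsUtilitarianOptimal, Set.ofPred_forall]
    exact isClosed_iInter fun y => isClosed_le continuous_const hW
  obtain ⟨x, hx, hmin⟩ :=
    hcl.isCompact.exists_isMinOn ⟨x₀, fun y => hx₀ (mem_univ y)⟩ hD.continuousOn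
  exact ⟨x, hx, fun y hy => hmin hy⟩

/-- The utilitarian rule with maximum-entropy tie-breaking. -/
def util (m : ℕ) [NeZero m] : AggregationRule m := fun _ I =>
  Classical.choose (exists_isUtilOutcome I)

/-- The agents' disutilities from `x`, sorted in non-increasing order. -/
def disutilityVector {n m : ℕ} (I : Profile n m) (x : Simplex m) : Fin n → ℝ := fun k =>
  nthLargest (Finset.univ.val.map fun i => disutility (I i) x) k

/-- `LexGT v w` means that `v` is lexicographically larger than `w`. -/
def LexGT {n : ℕ} (v w : Fin n → ℝ) : Prop :=
  ∃ k, (∀ l, l < k → v l = w l) ∧ w k < v k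

/-- `x` is an egalitarian outcome with leximin tie-breaking. In particular `x` maximizes the
egalitarian welfare, since the first entry of the disutility vector is the largest disutility. -/
def IsEgalOutcome {n m : ℕ} (I : Profile n m) (x : Simplex m) : Prop :=
  ∀ y, disutilityVector I x = disutilityVector I y ∨
    LexGT (disutilityVector I y) (disutilityVector I x)

/-- `F` is an egalitarian rule with leximin tie-breaking; the ties that remain may be broken in
any way. -/
def IsEgalRule {m : ℕ} (F : AggregationRule m) : Prop :=
  ∀ (n : ℕ) (I : Profile n m), IsEgalOutcome I (F n I)

theorem exists_lexMin {X : Type*} [TopologicalSpace X] [CompactSpace X] [Nonempty X] {n : ℕ}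
    (g : Fin n → X → ℝ) (hg : ∀ k, Continuous (g k)) :
    ∃ x, ∀ y, (∀ k, g k x = g k y) ∨ ∃ k, (∀ l, l < k → g l y = g l x) ∧ g k x < g k y := by
  suffices h : ∀ K : Set X, IsCompact K → K.Nonempty → ∃ x ∈ K, ∀ y ∈ K,
      (∀ k, g k x = g k y) ∨ ∃ k, (∀ l, l < k → g l y = g l x) ∧ g k x < g k y by
    obtain ⟨x, -, hx⟩ := h univ isCompact_univ univ_nonempty
    exact ⟨x, fun y => hx y (mem_univ y)⟩
  induction n with
  | zero =>
    rintro K - ⟨x, hx⟩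
    exact ⟨x, hx, fun y _ => Or.inl fun k => k.elim0⟩
  | succ n ih =>
    intro K hK hne
    obtain ⟨x₀, hx₀, hmin⟩ := hK.exists_isMinOn hne (hg 0).continuousOn
    have hK' : IsCompact (K ∩ {x | g 0 x ≤ g 0 x₀}) :=
      hK.inter_right (isClosed_le (hg 0) continuous_const)
    obtain ⟨x, ⟨hxK, hx0⟩, hx⟩ := ih (fun k => g k.succ) (fun k => hg k.succ) _ hK'
      ⟨x₀, hx₀, le_refl (g 0 x₀)⟩
    have hx0' : g 0 x = g 0 x₀ := le_antisymm hx0 (hmin hxK)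
    refine ⟨x, hxK, fun y hy => ?_⟩
    have hy0 : g 0 x₀ ≤ g 0 y := hmin hy
    rcases hy0.lt_or_eq with h | h
    · exact Or.inr ⟨0, fun l hl => absurd hl (Fin.not_lt_zero l), hx0'.trans_lt h⟩
    · rcases hx y ⟨hy, h.ge⟩ with h1 | ⟨k, h1, h2⟩
      · left
        intro k
        cases k using Fin.cases with
        | zero => rw [hx0', h]
        | succ k => exact h1 k
      · right
        refine ⟨k.succ, fun l hl => ?_, h2⟩
        cases l using Fin.cases with
        | zero => rw [hx0', h]
        | succ l => exact h1 l (Fin.succ_lt_succ_iff.1 hl)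

theorem exists_isEgalRule (m : ℕ) [NeZero m] : ∃ F : AggregationRule m, IsEgalRule F := by
  have h : ∀ (n : ℕ) (I : Profile n m), ∃ x, IsEgalOutcome I x := by
    intro n I
    have hc : ∀ k : Fin n, Continuous fun x => disutilityVector I x k := by
      intro k
      have := continuous_nthLargest (Finset.univ.val.map fun i => disutility (I i)) (by
        intro g hg
        obtain ⟨i, -, rfl⟩ := Multiset.mem_map.1 hg
        exact continuous_disutility _) k
      simpa only [Multiset.map_map, Function.comp_def, disutilityVector] using this
    have : Nonempty (Simplex m) := ⟨uniform m⟩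
    obtain ⟨x, hx⟩ := exists_lexMin (fun k x => disutilityVector I x k) hc
    exact ⟨x, fun y => (hx y).imp (fun h => funext h) id⟩
  choose F hF using h
  exact ⟨F, hF⟩

/-! ### The independent markets rule -/

/-- The phantom functions `f₀, f₁, …` of the independent markets rule. -/
def phantom (k : ℕ) (t : ℝ) : ℝ := if t < 1 then min (k * t) 1 else 1

/-- The median of the scores of candidate `j` and the values of the `n + 1` phantoms at `t`. -/
def imScore {n m : ℕ} (I : Profile n m) (t : ℝ) (j : Fin m) : ℝ :=
  median ((Finset.univ.val.map fun i => I i j) +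
    (Finset.univ.val.map fun k : Fin (n + 1) => phantom k t))

/-- `t` is the smallest number in `[0, 1]` at which the medians sum up to `1`. -/
def IsThreshold {n m : ℕ} (I : Profile n m) (t : ℝ) : Prop :=
  IsLeast {t | t ∈ Icc (0 : ℝ) 1 ∧ ∑ j, imScore I t j = 1} t

theorem imScore_eq {n m : ℕ} (I : Profile n m) (t : ℝ) (j : Fin m) :
    imScore I t j = nthLargest ((Finset.univ.val.map fun i => I i j) +
      (Finset.univ.val.map fun k : Fin (n + 1) => phantom k t)) n := by
  have hc : ((Finset.univ.val.map fun i => I i j) +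
      (Finset.univ.val.map fun k : Fin (n + 1) => phantom k t)).card = 2 * n + 1 := by
    simp
    ring
  have h1 : (2 * n + 1 - 1) / 2 = n := by omega
  have h2 : (2 * n + 1) / 2 = n := by omega
  rw [imScore, median, hc, h1, h2]
  ring

theorem le_imScore {n m : ℕ} (I : Profile n m) (t c : ℝ) (j : Fin m) (A : Finset (Fin n))
    (B : Finset (Fin (n + 1))) (hA : ∀ i ∈ A, c ≤ I i j) (hB : ∀ k ∈ B, c ≤ phantom k t)
    (hcard : n < A.card + B.card) : c ≤ imScore I t j := by
  rw [imScore_eq]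
  rw [nthLargest_iff (fun a => c ≤ a) (fun a b hab h => h.trans hab) _ _ (by simp),
    Multiset.countP_add, Multiset.countP_map, Multiset.countP_map]
  have h1 : A.card ≤ (Finset.univ.filter fun i => c ≤ I i j).card :=
    Finset.card_le_card fun i hi => Finset.mem_filter.2 ⟨Finset.mem_univ _, hA i hi⟩
  have h2 : B.card ≤ (Finset.univ.filter fun k : Fin (n + 1) => c ≤ phantom k t).card :=
    Finset.card_le_card fun k hk => Finset.mem_filter.2 ⟨Finset.mem_univ _, hB k hk⟩
  exact hcard.trans_le (add_le_add h1 h2)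

theorem imScore_nonneg {n m : ℕ} (I : Profile n m) {t : ℝ} (ht : 0 ≤ t) (j : Fin m) :
    0 ≤ imScore I t j := by
  refine median_nonneg fun a ha => ?_
  rcases Multiset.mem_add.1 ha with h | h
  · obtain ⟨i, -, rfl⟩ := Multiset.mem_map.1 h
    exact (I i).2.1 j
  · obtain ⟨k, -, rfl⟩ := Multiset.mem_map.1 h
    unfold phantom
    split_ifs
    · positivity
    · positivity

theorem imScore_zero {n m : ℕ} (I : Profile n m) (j : Fin m) : imScore I 0 j = 0 := by
  refine le_antisymm (not_lt.1 fun h => ?_) (imScore_nonneg I le_rfl j)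
  rw [imScore_eq, nthLargest_iff (fun a => 0 < a) (fun a b hab h => h.trans_le hab) _ _
    (by simp), Multiset.countP_add] at h
  have h1 : (Finset.univ.val.map fun i => I i j).countP (fun a => 0 < a) ≤ n :=
    (Multiset.countP_le_card _ _).trans (by simp)
  have h2 : (Finset.univ.val.map fun k : Fin (n + 1) => phantom k 0).countP (fun a => 0 < a) = 0 := by
    rw [Multiset.countP_eq_zero]
    intro a ha
    obtain ⟨k, -, rfl⟩ := Multiset.mem_map.1 ha
    simp [phantom]
  omega

theorem exists_continuous_imScore {n m : ℕ} (I : Profile n m) :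
    ∃ g : ℝ → ℝ, Continuous g ∧ ∀ t < 1, ∑ j, imScore I t j = g t := by
  refine ⟨fun t => ∑ j, nthLargest (((Finset.univ.val.map fun i => fun _ : ℝ => I i j) +
      (Finset.univ.val.map fun k : Fin (n + 1) => fun t : ℝ => min ((k : ℕ) * t) 1)).map
        fun g => g t) n, ?_, ?_⟩
  · refine continuous_finsetSum _ fun j _ => continuous_nthLargest _ ?_ _
    intro g hg
    rcases Multiset.mem_add.1 hg with h | h
    · obtain ⟨i, -, rfl⟩ := Multiset.mem_map.1 h
      exact continuous_const
    · obtain ⟨k, -, rfl⟩ := Multiset.mem_map.1 h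
      fun_prop
  · intro t ht
    refine Finset.sum_congr rfl fun j _ => ?_
    simp only [imScore_eq, phantom, if_pos ht, Multiset.map_add, Multiset.map_map,
      Function.comp_def]

theorem exists_one_le_sum_imScore {n m : ℕ} (I : Profile (n + 2) m) :
    ∃ t, 0 ≤ t ∧ t < 1 ∧ 1 ≤ ∑ j, imScore I t j := by
  have hph : ∀ (t : ℝ) (k a : ℕ), 0 ≤ t → t < 1 → a ≤ k → min (a * t) 1 ≤ phantom k t := by
    intro t k a h0 h1 hk
    rw [phantom, if_pos h1]
    have : (a : ℝ) ≤ k := by exact_mod_cast hk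
    gcongr
  by_cases h : I 0 = I 1
  · refine ⟨1 / 2, by norm_num, by norm_num, ?_⟩
    have e0 : ∑ j, I 0 j = 1 := (I 0).2.2
    refine e0.ge.trans (Finset.sum_le_sum fun j _ => ?_)
    have hv2 : ((2 : Fin (n + 2 + 1)) : ℕ) = 2 := Nat.mod_eq_of_lt (show 2 < n + 2 + 1 by omega)
    refine le_imScore I _ _ j {0, 1} (Finset.Ici 2) ?_ ?_ ?_
    · intro i hi
      rcases Finset.mem_insert.1 hi with rfl | hi
      · exact le_rfl
      · rw [Finset.mem_singleton.1 hi, ← h]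
    · intro k hk
      have h2 : 2 ≤ (k : ℕ) := by
        have := Fin.le_def.1 (Finset.mem_Ici.1 hk)
        rwa [hv2] at this
      refine le_trans ?_ (hph _ _ 2 (by norm_num) (by norm_num) h2)
      norm_num
    · have h01 : ({0, 1} : Finset (Fin (n + 2))).card = 2 := Finset.card_pair (by simp)
      rw [h01, Fin.card_Ici, hv2]
      omega
  · have hgt : 1 < ∑ j, max (I 0 j) (I 1 j) := by
      by_contra hle
      have e0 : ∑ j, I 0 j = 1 := (I 0).2.2
      have e1 : ∑ j, I 1 j = 1 := (I 1).2.2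
      have a0 : ∀ j ∈ Finset.univ, I 0 j = max (I 0 j) (I 1 j) :=
        (Finset.sum_eq_sum_iff_of_le fun j _ => le_max_left _ _).1
          (le_antisymm (Finset.sum_le_sum fun j _ => le_max_left _ _) (by rw [e0]; exact not_lt.1 hle))
      have a1 : ∀ j ∈ Finset.univ, I 1 j = max (I 0 j) (I 1 j) :=
        (Finset.sum_eq_sum_iff_of_le fun j _ => le_max_right _ _).1
          (le_antisymm (Finset.sum_le_sum fun j _ => le_max_right _ _) (by rw [e1]; exact not_lt.1 hle))
      apply h
      ext j
      rw [a0 j (Finset.mem_univ j), ← a1 j (Finset.mem_univ j)]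
    have hcont : Continuous fun t : ℝ => ∑ j, min (max (I 0 j) (I 1 j)) t := by fun_prop
    have h1 : 1 < ∑ j, min (max (I 0 j) (I 1 j)) 1 := by
      refine hgt.trans_eq (Finset.sum_congr rfl fun j _ => ?_)
      exact (min_eq_left (max_le (stdSimplex.le_one _ _) (stdSimplex.le_one _ _))).symm
    have hev : ∀ᶠ t in 𝓝[<] (1 : ℝ), 1 < ∑ j, min (max (I 0 j) (I 1 j)) t :=
      (hcont.continuousAt.eventually (lt_mem_nhds h1)).filter_mono nhdsWithin_le_nhds
    obtain ⟨t, ht, ht0, ht1⟩ :=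
      (hev.and (Ioo_mem_nhdsLT (zero_lt_one' ℝ))).exists
    refine ⟨t, ht0.le, ht1, ht.le.trans (Finset.sum_le_sum fun j _ => ?_)⟩
    have key : ∀ i, min (I i j) t ≤ imScore I t j := by
      intro i
      refine le_imScore I _ _ j {i} (Finset.Ici 1) ?_ ?_ ?_
      · intro i' hi
        rw [Finset.mem_singleton.1 hi]
        exact min_le_left _ _
      · intro k hk
        have h2 : 1 ≤ (k : ℕ) := by
          have := Fin.le_def.1 (Finset.mem_Ici.1 hk)
          simpa using this
        refine le_trans ?_ (hph _ _ 1 ht0.le ht1 h2)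
        simp [ht1.le]
      · rw [Fin.card_Ici]
        simp
    rcases le_total (I 0 j) (I 1 j) with hle | hle
    · rw [max_eq_right hle]
      exact key 1
    · rw [max_eq_left hle]
      exact key 0

theorem exists_isThreshold {n m : ℕ} (I : Profile (n + 2) m) : ∃ t, IsThreshold I t := by
  obtain ⟨g, hg, hgs⟩ := exists_continuous_imScore I
  obtain ⟨t₀, h0, h1, hs⟩ := exists_one_le_sum_imScore I
  have hz : g 0 = 0 := by
    rw [← hgs 0 one_pos]
    exact Finset.sum_eq_zero fun j _ => imScore_zero I j
  obtain ⟨t₁, ht₁, he⟩ := intermediate_value_Icc h0 hg.continuousOn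
    (show (1 : ℝ) ∈ Icc (g 0) (g t₀) from ⟨by rw [hz]; exact zero_le_one, by rw [← hgs _ h1]; exact hs⟩)
  have hK : IsCompact (Icc 0 t₀ ∩ g ⁻¹' {1}) :=
    isCompact_Icc.inter_right (isClosed_singleton.preimage hg)
  obtain ⟨t, ⟨⟨hta, htb⟩, hte⟩, hleast⟩ := hK.exists_isLeast ⟨t₁, ht₁, he⟩
  refine ⟨t, ⟨⟨hta, htb.trans h1.le⟩, ?_⟩, ?_⟩
  · rw [hgs t (htb.trans_lt h1)]
    exact hte
  · rintro s ⟨⟨hsa, hsb⟩, hse⟩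
    rcases le_or_gt s t₀ with h | h
    · refine hleast ⟨⟨hsa, h⟩, ?_⟩
      rw [mem_preimage, ← hgs s (h.trans_lt h1)]
      exact hse
    · exact htb.trans h.le

/-- The independent markets rule. With at least two agents the threshold exists; a single agent
(whose threshold need not exist) receives her ideal distribution. -/
def im (m : ℕ) [NeZero m] : AggregationRule m
  | 0, _ => uniform m
  | 1, I => I 0
  | _ + 2, I =>
    ⟨imScore I (Classical.choose (exists_isThreshold I)),
      imScore_nonneg I (Classical.choose_spec (exists_isThreshold I)).1.1.1,
      (Classical.choose_spec (exists_isThreshold I)).1.2⟩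

end Portioning

end

open Portioning

namespace Portioning

/-! Since all distributions have total mass one, an agent's disutility is twice the total amount by
which the outcome overshoots her ideal, and also twice the total amount by which it undershoots. To
see that a deviation or an abstention does not help, it therefore suffices that no overshot
coordinate goes down, or that no undershot coordinate goes up (`disutility_le_of_overshoot`,
`disutility_le_of_undershoot`). Neither can fail without the other unless two coordinates cross
(`disutility_le_of_no_crossing`). Most positive claims reduce to one of these three criteria.

For IM the two thresholds decide which criterion applies: phantoms grow with `t`, so if the
threshold does not fall, overshot coordinates cannot drop, and otherwise undershot ones cannot rise.
For Util, moving a little mass from one candidate to another yields an inequality between counts of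
scores, refined by the quadratic tie-break (`IsUtilOutcome.lex_le`); applied to both outcomes, it
rules out a crossing pair. Max falls under the overshoot criterion, Min and Geo under the undershoot
criterion apart from the case where all aggregated scores vanish; Geo also needs the weighted AM-GM
inequality. Avg contracts every coordinate difference by a constant factor. With two candidates the
coordinate medians already sum to one, so Med reduces to the monotonicity of a single median.

Egal needs another idea: against a fixed competitor, a leximin outcome minimizes the additive
quantity `∑ exp (T * dᵢ)` for all large `T`. Adding the optimality inequalities with and without the
agent cancels everyone else's terms.

Every failure of strategyproofness is shown by a misreport that produces exactly the manipulator's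
ideal, while the truth does not (`not_strategyproofFor_of_cons`). The failure of participation for
Med works alike: the outcome without the agent is already her ideal, and her vote moves it away. -/

/-! ### The disutility as overshoot or undershoot -/

theorem disutility_eq_two_mul_sum_pos {m : ℕ} (s x : Simplex m) :
    disutility s x = 2 * ∑ j, max (x j - s j) 0 := by
  have hs : ∑ j, s j = 1 := s.2.2
  have hx : ∑ j, x j = 1 := x.2.2
  have h : ∀ j, |s j - x j| = 2 * max (x j - s j) 0 + s j - x j := by
    intro j
    rcases le_total (s j) (x j) with h | h
    · rw [abs_of_nonpos (by linarith), max_eq_left (by linarith)]; ring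
    · rw [abs_of_nonneg (by linarith), max_eq_right (by linarith)]; ring
  simp only [disutility, h, Finset.sum_sub_distrib, Finset.sum_add_distrib, ← Finset.mul_sum]
  linarith

theorem disutility_comm {m : ℕ} (s x : Simplex m) : disutility s x = disutility x s := by
  simp only [disutility, abs_sub_comm]

theorem disutility_le_of_overshoot {m : ℕ} {s x x' : Simplex m}
    (h : ∀ j, s j < x j → x j ≤ x' j) : disutility s x ≤ disutility s x' := by
  rw [disutility_eq_two_mul_sum_pos, disutility_eq_two_mul_sum_pos]
  gcongr 2 * ∑ j, ?_ with j
  rcases lt_or_ge (s j) (x j) with hj | hj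
  · have := h j hj
    gcongr
  · rw [max_eq_right (by linarith)]
    exact le_max_right _ _

theorem disutility_le_of_undershoot {m : ℕ} {s x x' : Simplex m}
    (h : ∀ j, x j < s j → x' j ≤ x j) : disutility s x ≤ disutility s x' := by
  rw [disutility_comm s x, disutility_comm s x', disutility_eq_two_mul_sum_pos,
    disutility_eq_two_mul_sum_pos]
  gcongr 2 * ∑ j, ?_ with j
  rcases lt_or_ge (x j) (s j) with hj | hj
  · have := h j hj
    gcongr
  · rw [max_eq_right (by linarith)]
    exact le_max_right _ _

/-- If some overshot coordinate `j` decreases, the hypothesis for this `j` forbids every undershot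
coordinate from increasing. -/
theorem disutility_le_of_no_crossing {m : ℕ} {s x x' : Simplex m}
    (h : ∀ j k, s j < x j → x' j < x j → x k < s k → x k < x' k → False) :
    disutility s x ≤ disutility s x' := by
  by_cases h1 : ∀ j, s j < x j → x j ≤ x' j
  · exact disutility_le_of_overshoot h1
  · push Not at h1
    obtain ⟨j, h1, h2⟩ := h1
    exact disutility_le_of_undershoot fun k h3 => not_lt.1 fun h4 => h j k h1 h2 h3 h4

theorem disutility_self {m : ℕ} (s : Simplex m) : disutility s s = 0 := by
  simp [disutility]

theorem disutility_nonneg {m : ℕ} (s x : Simplex m) : 0 ≤ disutility s x :=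
  Finset.sum_nonneg fun _ _ => abs_nonneg _

theorem eq_of_disutility_le_zero {m : ℕ} {s x : Simplex m} (h : disutility s x ≤ 0) : x = s := by
  have h0 : disutility s x = 0 := le_antisymm h (disutility_nonneg s x)
  ext j
  have := (Finset.sum_eq_zero_iff_of_nonneg fun j _ => abs_nonneg (s j - x j)).1 h0 j
    (Finset.mem_univ j)
  rw [abs_eq_zero] at this
  linarith

theorem disutility_le_two {m : ℕ} (s x : Simplex m) : disutility s x ≤ 2 := by
  have hs : ∑ j, s j = 1 := s.2.2
  have hx : ∑ j, x j = 1 := x.2.2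
  have : disutility s x ≤ ∑ j, (s j + x j) := Finset.sum_le_sum fun j _ => by
    have h1 : 0 ≤ s j := s.2.1 j
    have h2 : 0 ≤ x j := x.2.1 j
    rw [abs_le]
    constructor <;> linarith
  rw [Finset.sum_add_distrib] at this
  linarith

theorem disutility_eq_two_of_disjoint {m : ℕ} {s x : Simplex m} (h : ∀ j, s j = 0 ∨ x j = 0) :
    disutility s x = 2 := by
  have hs : ∑ j, s j = 1 := s.2.2
  have hx : ∑ j, x j = 1 := x.2.2
  have : disutility s x = ∑ j, (s j + x j) := Finset.sum_congr rfl fun j _ => by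
    have h1 : 0 ≤ s j := s.2.1 j
    have h2 : 0 ≤ x j := x.2.1 j
    rcases h j with h | h
    · rw [h, zero_sub, abs_neg, abs_of_nonneg h2, zero_add]
    · rw [h, sub_zero, abs_of_nonneg h1, add_zero]
  rw [this, Finset.sum_add_distrib]
  linarith

theorem not_strategyproofFor_of_cons {m n : ℕ} {F : AggregationRule m} (R : Profile n m)
    (s s' : Simplex m) (h' : F (n + 1) (Fin.cons s' R : Profile (n + 1) m) = s)
    (h : F (n + 1) (Fin.cons s R : Profile (n + 1) m) ≠ s) : ¬ StrategyproofFor F (n + 1) := by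
  intro hF
  have := hF (Fin.cons s R) (Fin.cons s' R) 0 fun i hi => by
    obtain ⟨k, rfl⟩ := Fin.exists_succ_eq.2 hi
    rfl
  rw [h', Fin.cons_zero, disutility_self] at this
  exact h (eq_of_disutility_le_zero this)

/-! ### Score multisets and ranks as counts -/

/-- The scores of candidate `j`. -/
def scores {n m : ℕ} (I : Profile n m) (j : Fin m) : Multiset ℝ :=
  Finset.univ.val.map fun i => I i j

theorem univ_val_map_succAbove {α : Type*} {n : ℕ} (v : Fin (n + 1) → α) (i : Fin (n + 1)) :
    Finset.univ.val.map v = v i ::ₘ Finset.univ.val.map fun k => v (i.succAbove k) := by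
  rw [Fin.univ_succAbove n i, Finset.cons_val, Multiset.map_cons, Finset.map_val,
    Multiset.map_map]
  rfl

theorem scores_succAbove {n m : ℕ} (I : Profile (n + 1) m) (i : Fin (n + 1)) (j : Fin m) :
    scores I j = I i j ::ₘ scores (fun k => I (i.succAbove k)) j :=
  univ_val_map_succAbove (fun i => I i j) i

theorem card_scores {n m : ℕ} (I : Profile n m) (j : Fin m) : (scores I j).card = n := by
  simp [scores]

/-- Ranks become counts, which makes the effect of one agent transparent: her score contributes at
most one to any count. -/
theorem le_nthLargest_iff {M : Multiset ℝ} {k : ℕ} (hk : k < M.card) (c : ℝ) :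
    c ≤ nthLargest M k ↔ k < M.countP (c ≤ ·) :=
  nthLargest_iff (fun a => c ≤ a) (fun _ _ hab h => h.trans hab) M k hk

theorem nthLargest_le_iff {M : Multiset ℝ} {k : ℕ} (hk : k < M.card) (c : ℝ) :
    nthLargest M k ≤ c ↔ M.countP (c < ·) ≤ k := by
  rw [← not_lt, ← not_lt,
    nthLargest_iff (fun a => c < a) (fun _ _ hab h => h.trans_le hab) M k hk]

theorem countP_mono_pred {α : Type*} (M : Multiset α) (p q : α → Prop) [DecidablePred p]
    [DecidablePred q] (h : ∀ a, p a → q a) : M.countP p ≤ M.countP q := by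
  rw [Multiset.countP_eq_card_filter, Multiset.countP_eq_card_filter]
  exact Multiset.card_le_card (Multiset.monotone_filter_right M h)

theorem strategyproofFor_succ_iff {m n : ℕ} {F : AggregationRule m} :
    StrategyproofFor F (n + 1) ↔ ∀ (I I' : Profile (n + 1) m) (i : Fin (n + 1)),
      (fun k => I (i.succAbove k)) = (fun k => I' (i.succAbove k)) →
      disutility (I i) (F (n + 1) I) ≤ disutility (I i) (F (n + 1) I') := by
  refine forall_congr' fun I => forall_congr' fun I' => forall_congr' fun i => ?_
  refine imp_congr_left ⟨fun h => funext fun k => h _ (Fin.succAbove_ne i k), fun h i' hi => ?_⟩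
  obtain ⟨k, rfl⟩ := Fin.exists_succAbove_eq hi
  exact congrFun h k

/-! ### The utilitarian rule -/

theorem exists_transfer {m : ℕ} (x : Simplex m) {j k : Fin m} (hjk : j ≠ k) {ε : ℝ} (h0 : 0 ≤ ε)
    (h1 : ε ≤ x j) : ∃ y : Simplex m, y j = x j - ε ∧ y k = x k + ε ∧
      ∀ l, l ≠ j → l ≠ k → y l = x l := by
  have hx : ∑ l, x l = 1 := x.2.2
  refine ⟨⟨fun l => x l + (if l = k then ε else 0) - (if l = j then ε else 0), fun l => ?_, ?_⟩,
    ?_, ?_, ?_⟩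
  · have : 0 ≤ x l := x.2.1 l
    by_cases hl : l = j
    · subst hl
      simp [hjk, h1]
    · simp only [hl, if_false]
      split_ifs <;> linarith
  · simp [Finset.sum_add_distrib, Finset.sum_sub_distrib, hx]
  · change x j + (if j = k then ε else 0) - (if j = j then ε else 0) = _
    simp [hjk]
  · change x k + (if k = k then ε else 0) - (if k = j then ε else 0) = _
    simp [hjk.symm]
  · intro l hl hl'
    change x l + (if l = k then ε else 0) - (if l = j then ε else 0) = _
    simp [hl, hl']

theorem sum_eq_add_add_sum_transfer {m : ℕ} {j k : Fin m} (hjk : j ≠ k) (f g : Fin m → ℝ)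
    (h : ∀ l, l ≠ j → l ≠ k → f l = g l) :
    ∑ l, f l - ∑ l, g l = (f j - g j) + (f k - g k) := by
  rw [← Finset.sum_sub_distrib, ← Finset.sum_subset (Finset.subset_univ {j, k}),
    Finset.sum_pair hjk]
  intro l _ hl
  simp only [Finset.mem_insert, Finset.mem_singleton, not_or] at hl
  rw [h l hl.1 hl.2, sub_self]

theorem sum_ite_neg {n : ℕ} (p : Fin n → Prop) [DecidablePred p] (ε : ℝ) :
    ∑ i, (if p i then ε else -ε) = (2 * ((Finset.univ.filter p).card : ℝ) - n) * ε := by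
  have h1 : ∀ i, (if p i then ε else -ε) = 2 * ε * (if p i then 1 else 0) - ε := by
    intro i; split_ifs <;> ring
  simp only [h1, Finset.sum_sub_distrib, ← Finset.mul_sum, Finset.sum_boole, Finset.sum_const,
    Finset.card_univ, Fintype.card_fin, nsmul_eq_mul]
  ring

/-- By `h1` and `h2` the transfer passes no agent's score, so each agent's disutility changes by
exactly `±ε` at each of the two candidates, and the welfare is linear in `ε`. -/
theorem utilitarianWelfare_transfer {n m : ℕ} (I : Profile n m) {x y : Simplex m} {j k : Fin m}
    (hjk : j ≠ k) {ε : ℝ} (h0 : 0 ≤ ε) (hj : y j = x j - ε) (hk : y k = x k + ε)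
    (hl : ∀ l, l ≠ j → l ≠ k → y l = x l)
    (h1 : ∀ i, I i j < x j → I i j ≤ x j - ε) (h2 : ∀ i, x k < I i k → x k + ε ≤ I i k) :
    utilitarianWelfare I y - utilitarianWelfare I x =
      2 * (((scores I k).countP (x k < ·) : ℝ) - (scores I j).countP (x j ≤ ·)) * ε := by
  have key : ∀ i, disutility (I i) y - disutility (I i) x =
      (if x j ≤ I i j then ε else -ε) - (if x k < I i k then ε else -ε) := by
    intro i
    unfold disutility
    rw [sum_eq_add_add_sum_transfer hjk _ _ fun l h1 h2 => by rw [hl l h1 h2], hj, hk]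
    have e1 : |I i j - (x j - ε)| - |I i j - x j| = if x j ≤ I i j then ε else -ε := by
      split_ifs with h
      · rw [abs_of_nonneg (by linarith), abs_of_nonneg (by linarith)]; ring
      · have := h1 i (not_le.1 h)
        rw [abs_of_nonpos (by linarith), abs_of_nonpos (by linarith)]; ring
    have e2 : |I i k - (x k + ε)| - |I i k - x k| = -if x k < I i k then ε else -ε := by
      split_ifs with h
      · have := h2 i h
        rw [abs_of_nonneg (by linarith), abs_of_nonneg (by linarith)]; ring
      · rw [abs_of_nonpos (by linarith), abs_of_nonpos (by linarith)]; ring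
    rw [e1, e2]; ring
  have hsum : ∑ i, disutility (I i) y - ∑ i, disutility (I i) x =
      ∑ i, (if x j ≤ I i j then ε else -ε) - ∑ i, (if x k < I i k then ε else -ε) := by
    rw [← Finset.sum_sub_distrib, ← Finset.sum_sub_distrib]
    exact Finset.sum_congr rfl fun i _ => key i
  rw [sum_ite_neg, sum_ite_neg] at hsum
  have c1 : (scores I j).countP (x j ≤ ·) = (Finset.univ.filter fun i => x j ≤ I i j).card := by
    rw [scores, Multiset.countP_map]; rfl
  have c2 : (scores I k).countP (x k < ·) = (Finset.univ.filter fun i => x k < I i k).card := by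
    rw [scores, Multiset.countP_map]; rfl
  rw [c1, c2]
  unfold utilitarianWelfare
  linarith

/-- First-order condition for shifting mass from `j` to `k`: the shift cannot raise welfare, and if
it is welfare-neutral, it cannot bring the outcome closer to uniform. -/
theorem IsUtilOutcome.lex_le {n m : ℕ} {I : Profile n m} {x : Simplex m} (hx : IsUtilOutcome I x)
    (j k : Fin m) : (scores I k).countP (x k < ·) ≤ (scores I j).countP (x j ≤ ·) ∧
      ((scores I k).countP (x k < ·) = (scores I j).countP (x j ≤ ·) → x j ≤ x k) := by
  have hk0 : 0 ≤ x k := x.2.1 k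
  rcases eq_or_ne j k with rfl | hjk
  · exact ⟨countP_mono_pred _ _ _ fun a h => le_of_lt h, fun _ => le_rfl⟩
  rcases (show 0 ≤ x j from x.2.1 j).eq_or_lt with hj | hj
  -- There is no mass to move away from `j`, but all `n` scores are at least `0`, so the count at
  -- `j` is maximal.
  · rw [← hj]
    refine ⟨?_, fun _ => hk0⟩
    have : (scores I j).countP (0 ≤ ·) = (scores I j).card := by
      rw [Multiset.countP_eq_card]
      intro a ha
      obtain ⟨i, -, rfl⟩ := Multiset.mem_map.1 ha
      exact (I i).2.1 j
    rw [this, card_scores]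
    exact (Multiset.countP_le_card _ _).trans (card_scores I k).le
  have hev : ∀ᶠ ε in 𝓝[>] (0 : ℝ), 0 < ε ∧ ε ≤ x j ∧ (∀ i, I i j < x j → I i j ≤ x j - ε) ∧
      (∀ i, x k < I i k → x k + ε ≤ I i k) ∧ (x k < x j → ε < x j - x k) := by
    have hlt : ∀ a : ℝ, 0 < a → ∀ᶠ ε in 𝓝[>] (0 : ℝ), ε < a := fun a ha =>
      (eventually_lt_nhds ha).filter_mono nhdsWithin_le_nhds
    have hfa : ∀ (p : Fin n → Prop) (a : Fin n → ℝ), (∀ i, p i → 0 < a i) →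
        ∀ᶠ ε in 𝓝[>] (0 : ℝ), ∀ i, p i → ε < a i := fun p a ha => by
      refine Filter.eventually_all.2 fun i => ?_
      by_cases hp : p i
      · simpa [hp] using hlt _ (ha i hp)
      · simp [hp]
    have h5 : ∀ᶠ ε in 𝓝[>] (0 : ℝ), x k < x j → ε < x j - x k := by
      by_cases hp : x k < x j
      · simpa [hp] using hlt _ (sub_pos.2 hp)
      · simp [hp]
    filter_upwards [self_mem_nhdsWithin, hlt _ hj, hfa (fun i => I i j < x j) (fun i => x j - I i j)
      fun i hi => sub_pos.2 hi, hfa (fun i => x k < I i k) (fun i => I i k - x k)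
      fun i hi => sub_pos.2 hi, h5] with ε h1 h2 h3 h4 h5
    exact ⟨h1, h2.le, fun i hi => by linarith [h3 i hi], fun i hi => by linarith [h4 i hi], h5⟩
  obtain ⟨ε, h0, h1, h2, h3, h4⟩ := hev.exists
  obtain ⟨y, hyj, hyk, hyl⟩ := exists_transfer x hjk h0.le h1
  have hW := utilitarianWelfare_transfer I hjk h0.le hyj hyk hyl h2 h3
  have hle : (scores I k).countP (x k < ·) ≤ (scores I j).countP (x j ≤ ·) := by
    have h5 := hx.1 y
    by_contra! hlt
    have : ((scores I j).countP (x j ≤ ·) : ℝ) < (scores I k).countP (x k < ·) := by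
      exact_mod_cast hlt
    nlinarith [mul_pos (sub_pos.2 this) h0]
  refine ⟨hle, fun heq => not_lt.1 fun hlt => ?_⟩
  rw [heq, sub_self, mul_zero, zero_mul] at hW
  have hopt : IsUtilitarianOptimal I y := fun z => (hx.1 z).trans (by linarith)
  have h5 := hx.2 y hopt
  have h6 := sum_eq_add_add_sum_transfer hjk (fun l => (y l - 1 / (m : ℝ)) ^ 2)
    (fun l => (x l - 1 / (m : ℝ)) ^ 2) fun l h1 h2 => by simp only [hyl l h1 h2]
  unfold sqDistUniform at h5
  rw [hyj, hyk] at h6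
  -- The squared distance changes by `2 * ε * (ε - (x j - x k))`, which is negative for the chosen
  -- `ε`.
  nlinarith [h4 hlt]

theorem util_spec {n m : ℕ} [NeZero m] (I : Profile n m) : IsUtilOutcome I (util m n I) :=
  Classical.choose_spec (exists_isUtilOutcome I)

/-- `R` collects the other agents' scores; the two alternatives in `hI'` treat abstention and
misreport at once. -/
theorem IsUtilOutcome.disutility_le {N N' m : ℕ} {I : Profile N m} {I' : Profile N' m}
    {x x' s : Simplex m} (hx : IsUtilOutcome I x) (hx' : IsUtilOutcome I' x')
    (R : Fin m → Multiset ℝ) (hI : ∀ j, scores I j = s j ::ₘ R j)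
    (hI' : (∀ j, scores I' j = R j) ∨ ∃ s' : Simplex m, ∀ j, scores I' j = s' j ::ₘ R j) :
    disutility s x ≤ disutility s x' := by
  refine disutility_le_of_no_crossing fun j k h1 h2 h3 h4 => ?_
  have a1 := hx.lex_le j k
  have a2 := hx'.lex_le k j
  have b1 : (scores I j).countP (x j ≤ ·) ≤ (R j).countP (x' j < ·) := by
    rw [hI, Multiset.countP_cons_of_neg _ (not_le.2 h1)]
    exact countP_mono_pred _ _ _ fun a h => h2.trans_le h
  have b2 : (R j).countP (x' j < ·) ≤ (scores I' j).countP (x' j < ·) := by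
    rcases hI' with h | ⟨s', h⟩
    · rw [h]
    · rw [h]; exact Multiset.countP_le_of_le _ (Multiset.le_cons_self _ _)
  have b3 : (R k).countP (x' k ≤ ·) + 1 ≤ (scores I k).countP (x k < ·) := by
    rw [hI, Multiset.countP_cons_of_pos _ h3]
    gcongr
    exact countP_mono_pred _ _ _ fun a h => h4.trans_le h
  have b4 : (scores I' k).countP (x' k ≤ ·) ≤ (R k).countP (x' k ≤ ·) + 1 := by
    rcases hI' with h | ⟨s', h⟩
    · rw [h]; omega
    · rw [h, Multiset.countP_cons]; split_ifs <;> omega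
  -- The six inequalities close up into a cycle of counts, from the others' count at `k` plus one
  -- back to itself, so all are equalities. Both tie-breaks then apply and give `x' k ≤ x' j < x j ≤
  -- x k < x' k`.
  have := a1.2 (by omega)
  have := a2.2 (by omega)
  linarith

theorem strategyproof_util (m : ℕ) [NeZero m] : Strategyproof (util m) := by
  rintro (_ | n) h
  · omega
  · rw [strategyproofFor_succ_iff]
    intro I I' i hII
    refine (util_spec I).disutility_le (util_spec I') _ (scores_succAbove I i) (Or.inr ⟨I' i, ?_⟩)
    rw [hII]
    exact scores_succAbove I' i

theorem participation_util (m : ℕ) [NeZero m] : Participation (util m) := fun _ _ I i =>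
  (util_spec I).disutility_le (util_spec _) _ (scores_succAbove I i) (Or.inl fun _ => rfl)

/-! ### The independent markets rule -/

noncomputable section

/-- The values of the first `n + 1` phantoms at `t`. -/
def phantoms (n : ℕ) (t : ℝ) : Multiset ℝ :=
  Finset.univ.val.map fun k : Fin (n + 1) => phantom k t

theorem phantoms_succ (n : ℕ) (t : ℝ) :
    phantoms (n + 1) t = phantom (n + 1 : ℕ) t ::ₘ phantoms n t := by
  unfold phantoms
  rw [univ_val_map_succAbove _ (Fin.last (n + 1))]
  simp

theorem phantom_mono (k : ℕ) {t t' : ℝ} (h : t ≤ t') : phantom k t ≤ phantom k t' := by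
  unfold phantom
  split_ifs with h1 h2
  · gcongr
  · exact min_le_right _ _
  · linarith
  · exact le_rfl

theorem countP_phantoms_mono (n : ℕ) {t t' : ℝ} (h : t ≤ t') (p : ℝ → Prop) [DecidablePred p]
    (hp : ∀ a b, a ≤ b → p a → p b) : (phantoms n t).countP p ≤ (phantoms n t').countP p := by
  unfold phantoms
  rw [Multiset.countP_map, Multiset.countP_map]
  exact Multiset.card_le_card (Multiset.monotone_filter_right _ fun k => hp _ _ (phantom_mono k h))

theorem le_imScore_iff {n m : ℕ} (I : Profile n m) (t c : ℝ) (j : Fin m) :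
    c ≤ imScore I t j ↔ n < (scores I j).countP (c ≤ ·) + (phantoms n t).countP (c ≤ ·) := by
  rw [imScore_eq, le_nthLargest_iff (by simp), Multiset.countP_add]
  rfl

theorem imScore_le_iff {n m : ℕ} (I : Profile n m) (t c : ℝ) (j : Fin m) :
    imScore I t j ≤ c ↔ (scores I j).countP (c < ·) + (phantoms n t).countP (c < ·) ≤ n := by
  rw [imScore_eq, nthLargest_le_iff (by simp), Multiset.countP_add]
  rfl

/-- The agent's score lies below the level `imScore I t j`, so only the other scores and the
phantoms support that level. The former stay and the latter grow with `t`. -/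
theorem imScore_le_imScore_of_lt {n m : ℕ} {I I' : Profile n m} {t t' : ℝ} (h : t ≤ t')
    {j : Fin m} {a a' : ℝ} {R : Multiset ℝ} (hI : scores I j = a ::ₘ R)
    (hI' : scores I' j = a' ::ₘ R) (ha : a < imScore I t j) :
    imScore I t j ≤ imScore I' t' j := by
  have h1 := (le_imScore_iff I t _ j).1 le_rfl
  rw [hI, Multiset.countP_cons, if_neg (not_le.2 ha)] at h1
  rw [le_imScore_iff, hI']
  refine h1.trans_le (add_le_add (Multiset.countP_le_of_le _ (Multiset.le_cons_self _ _)) ?_)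
  exact countP_phantoms_mono n h _ fun _ _ hab h => h.trans hab

theorem imScore_le_imScore_of_gt {n m : ℕ} {I I' : Profile n m} {t t' : ℝ} (h : t' ≤ t)
    {j : Fin m} {a a' : ℝ} {R : Multiset ℝ} (hI : scores I j = a ::ₘ R)
    (hI' : scores I' j = a' ::ₘ R) (ha : imScore I t j < a) :
    imScore I' t' j ≤ imScore I t j := by
  have h1 := (imScore_le_iff I t _ j).1 le_rfl
  rw [hI, Multiset.countP_cons, if_pos ha] at h1
  have h2 := countP_phantoms_mono n h (imScore I t j < ·) fun _ _ hab h => h.trans_le hab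
  rw [imScore_le_iff, hI', Multiset.countP_cons]
  split_ifs <;> omega

/-- Removal also discards the last phantom. Her score was not among the entries reaching the level,
so at most one supporter is lost, while the number of required supporters also drops by one. -/
theorem imScore_le_imScore_remove_of_lt {n m : ℕ} {I : Profile (n + 1) m} {I' : Profile n m}
    {t t' : ℝ} (h : t ≤ t') {j : Fin m} {a : ℝ} (hI : scores I j = a ::ₘ scores I' j)
    (ha : a < imScore I t j) : imScore I t j ≤ imScore I' t' j := by
  have h1 := (le_imScore_iff I t _ j).1 le_rfl
  rw [hI, Multiset.countP_cons, if_neg (not_le.2 ha), phantoms_succ, Multiset.countP_cons] at h1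
  have h2 := countP_phantoms_mono n h (imScore I t j ≤ ·) fun _ _ hab h => h.trans hab
  rw [le_imScore_iff]
  split_ifs at h1 <;> omega

/-- Her score counts among the entries strictly above the level, so its removal compensates for the
lower bound on that count. -/
theorem imScore_remove_le_imScore_of_gt {n m : ℕ} {I : Profile (n + 1) m} {I' : Profile n m}
    {t t' : ℝ} (h : t' ≤ t) {j : Fin m} {a : ℝ} (hI : scores I j = a ::ₘ scores I' j)
    (ha : imScore I t j < a) : imScore I' t' j ≤ imScore I t j := by
  have h1 := (imScore_le_iff I t _ j).1 le_rfl
  rw [hI, Multiset.countP_cons, if_pos ha, phantoms_succ, Multiset.countP_cons] at h1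
  have h2 := countP_phantoms_mono n h (imScore I t j < ·) fun _ _ hab h => h.trans_le hab
  rw [imScore_le_iff]
  split_ifs at h1 <;> omega

theorem im_spec {n m : ℕ} [NeZero m] (I : Profile (n + 2) m) :
    ∃ t, IsThreshold I t ∧ ∀ j, im m (n + 2) I j = imScore I t j :=
  ⟨_, Classical.choose_spec (exists_isThreshold I), fun _ => rfl⟩

theorem IsThreshold.lt_one {n m : ℕ} (hm : 2 ≤ m) {I : Profile n m} {t : ℝ}
    (ht : IsThreshold I t) : t < 1 := by
  obtain ⟨⟨⟨-, h1⟩, hs⟩, -⟩ := ht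
  refine h1.lt_of_ne ?_
  rintro rfl
  -- At `t = 1` all `n + 1` phantoms equal `1`, a majority, so the medians would sum to at least
  -- `m`.
  have : ∑ _j : Fin m, (1 : ℝ) ≤ ∑ j, imScore I 1 j := Finset.sum_le_sum fun j _ =>
    le_imScore I 1 1 j ∅ Finset.univ (by simp) (by simp [phantom]) (by simp)
  have hm' : (2 : ℝ) ≤ m := by exact_mod_cast hm
  simp only [hs, Finset.sum_const, Finset.card_univ, Fintype.card_fin, nsmul_eq_mul,
    mul_one] at this
  linarith

theorem strategyproof_im (m : ℕ) [NeZero m] : Strategyproof (im m) := by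
  rintro (_ | _ | n) h
  · omega
  · intro I I' i _
    rw [Fin.fin_one_eq_zero i]
    exact (disutility_self (I 0)).trans_le (disutility_nonneg _ _)
  · rw [strategyproofFor_succ_iff]
    intro I I' i hII
    obtain ⟨t, -, ht⟩ := im_spec I
    obtain ⟨t', -, ht'⟩ := im_spec I'
    have hI := scores_succAbove I i
    have hI' := scores_succAbove I' i
    rw [← hII] at hI'
    rcases le_total t t' with h | h
    · refine disutility_le_of_overshoot fun j hj => ?_
      rw [ht] at hj
      rw [ht, ht']
      exact imScore_le_imScore_of_lt h (hI j) (hI' j) hj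
    · refine disutility_le_of_undershoot fun j hj => ?_
      rw [ht] at hj
      rw [ht, ht']
      exact imScore_le_imScore_of_gt h (hI j) (hI' j) hj

/-- For `t < 1` the phantom `f₀` is `0`, so at most two phantoms reach a positive level. The median
of five entries needs three, hence a score as well. This handles the passage to one agent, whose
outcome is not defined by phantoms. -/
theorem imScore_two_le {m : ℕ} {I : Profile 2 m} {t : ℝ} (ht : t < 1) {j : Fin m}
    {a b : ℝ} (ha0 : 0 ≤ a) (hI : scores I j = {a, b}) (ha : a < imScore I t j) :
    imScore I t j ≤ b := by
  by_contra! hb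
  have h1 := (le_imScore_iff I t _ j).1 le_rfl
  have h0 : ¬ imScore I t j ≤ phantom ((0 : Fin 3) : ℕ) t := by
    rw [Fin.val_zero, phantom, if_pos ht]
    simpa using ha0.trans_lt ha
  rw [hI, Multiset.insert_eq_cons, Multiset.countP_cons, if_neg (not_le.2 ha),
    ← Multiset.cons_zero, Multiset.countP_cons, if_neg (not_le.2 hb), Multiset.countP_zero,
    phantoms, univ_val_map_succAbove _ 0, Multiset.countP_cons, if_neg h0] at h1
  have h2 := Multiset.countP_le_card (imScore I t j ≤ ·)
    (Finset.univ.val.map fun k : Fin 2 => phantom ((0 : Fin 3).succAbove k : Fin 3) t)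
  simp only [Multiset.card_map, Finset.card_val, Finset.card_univ, Fintype.card_fin] at h2
  omega

theorem participation_im (m : ℕ) [NeZero m] (hm : 2 ≤ m) : Participation (im m) := by
  rintro (_ | _ | n) h I i
  · omega
  · obtain ⟨t, ht1, ht⟩ := im_spec I
    refine disutility_le_of_overshoot fun j hj => ?_
    rw [ht] at hj ⊢
    exact imScore_two_le (ht1.lt_one hm) ((I i).2.1 j) (scores_succAbove I i j) hj
  · obtain ⟨t, -, ht⟩ := im_spec I
    obtain ⟨t', -, ht'⟩ := im_spec fun k => I (i.succAbove k)
    have hI := scores_succAbove I i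
    rcases le_total t t' with h | h
    · refine disutility_le_of_overshoot fun j hj => ?_
      rw [ht] at hj
      rw [ht, ht']
      exact imScore_le_imScore_remove_of_lt h (hI j) hj
    · refine disutility_le_of_undershoot fun j hj => ?_
      rw [ht] at hj
      rw [ht, ht']
      exact imScore_remove_le_imScore_of_gt h (hI j) hj

end

/-! ### Coordinate-wise rules -/

section CoordinateWise

variable {m : ℕ} {f : ∀ n : ℕ, (Fin n → ℝ) → ℝ}
  {hf : ∀ n v, (∀ i, 0 ≤ v i) → 0 ≤ f n v} {n : ℕ} {I : Profile n m}

theorem sum_pos_of_ne_zero {l : Fin m} (h : f n (fun i => I i l) ≠ 0)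
    (hf : ∀ n v, (∀ i, 0 ≤ v i) → 0 ≤ f n v) : 0 < ∑ k, f n fun i => I i k := by
  have h0 : ∀ k ∈ Finset.univ, 0 ≤ f n fun i => I i k := fun k _ => hf _ _ fun i => (I i).2.1 k
  exact (Finset.sum_nonneg h0).lt_of_ne fun h1 =>
    h ((Finset.sum_eq_zero_iff_of_nonneg h0).1 h1.symm l (Finset.mem_univ l))

variable [NeZero m]

theorem coordinateWise_of_eq_zero (h : ∀ j, f n (fun i => I i j) = 0) :
    coordinateWise f hf n I = uniform m := by
  rw [coordinateWise, dif_pos h]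

theorem coordinateWise_apply {l : Fin m} (h : f n (fun i => I i l) ≠ 0) (j : Fin m) :
    coordinateWise f hf n I j = f n (fun i => I i j) / ∑ k, f n fun i => I i k := by
  rw [coordinateWise, dif_neg fun h0 => h (h0 l)]
  rfl

theorem coordinateWise_eq {x : Simplex m} {c : ℝ} (hc : c ≠ 0)
    (h : ∀ j, f n (fun i => I i j) = c * x j) : coordinateWise f hf n I = x := by
  have hx : ∑ j, x j = 1 := x.2.2
  have hs : ∑ k, f n (fun i => I i k) = c := by
    simp only [h, ← Finset.mul_sum, hx, mul_one]
  obtain ⟨l, -, hl⟩ := Finset.exists_ne_zero_of_sum_ne_zero (hs.trans_ne hc)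
  ext j
  rw [coordinateWise_apply hl, hs, h]
  field_simp

end CoordinateWise

/-- The distribution of the mass `1` over the first two candidates. -/
def pairDist {k : ℕ} (a : ℝ) (h0 : 0 ≤ a) (h1 : a ≤ 1) : Simplex (k + 2) :=
  ⟨Fin.cons a (Fin.cons (1 - a) 0), by
    refine Fin.cases ?_ (Fin.cases ?_ fun j => ?_) <;> simp [h0, h1], by
    simp [Fin.sum_univ_succ]⟩

section PairDist

variable {k : ℕ} {a : ℝ} (h0 : 0 ≤ a) (h1 : a ≤ 1)

@[simp] theorem pairDist_zero : (pairDist a h0 h1 : Simplex (k + 2)) 0 = a := rfl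

@[simp] theorem pairDist_one :
    (pairDist a h0 h1 : Simplex (k + 2)) 1 = 1 - a := rfl

@[simp] theorem pairDist_succ_succ (j : Fin k) :
    (pairDist a h0 h1 : Simplex (k + 2)) j.succ.succ = 0 := rfl

theorem pairDist_ne {b : ℝ} (h0' : 0 ≤ b) (h1' : b ≤ 1) (h : a ≠ b) :
    (pairDist a h0 h1 : Simplex (k + 2)) ≠ pairDist b h0' h1' := fun he =>
  h (congrArg (fun x : Simplex (k + 2) => x 0) he)

end PairDist

/-! ### The average rule -/

theorem not_strategyproofFor_avg {k n : ℕ} (hn : 1 ≤ n) :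
    ¬ StrategyproofFor (avg (k + 2)) (n + 1) := by
  have hn' : (1 : ℝ) ≤ n := by exact_mod_cast hn
  have hn0 : (n : ℝ) + 1 ≠ 0 := by positivity
  have hb : (n : ℝ) / (n + 1) ≤ 1 := by rw [div_le_one (by positivity)]; linarith
  have hc : ((n : ℝ) + n / (n + 1)) / (n + 1) ≤ 1 := by
    rw [div_le_one (by positivity)]; linarith
  -- With `n` agents at the first vertex, a vote for the second one produces the average `n / (n +
  -- 1)`, chosen as the ideal.
  refine not_strategyproofFor_of_cons (fun _ => pairDist 1 zero_le_one le_rfl)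
    (pairDist (n / (n + 1)) (by positivity) hb) (pairDist 0 le_rfl zero_le_one) ?_ ?_
  · refine coordinateWise_eq one_ne_zero ?_
    refine Fin.cases ?_ (Fin.cases ?_ fun j => ?_) <;> simp [Fin.sum_univ_succ]
    field_simp
    ring
  · have : avg (k + 2) (n + 1) (Fin.cons (pairDist (n / (n + 1)) (by positivity) hb)
        (fun _ => pairDist 1 zero_le_one le_rfl) : Profile (n + 1) (k + 2)) =
        pairDist (((n : ℝ) + n / (n + 1)) / (n + 1)) (by positivity) hc := by
      refine coordinateWise_eq one_ne_zero ?_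
      refine Fin.cases ?_ (Fin.cases ?_ fun j => ?_) <;> simp [Fin.sum_univ_succ]
      · ring
      · field_simp
        ring
    rw [this]
    refine pairDist_ne _ _ _ _ (ne_of_gt ?_)
    rw [div_lt_div_iff_of_pos_right (by positivity)]
    have : (0 : ℝ) < n / (n + 1) := by positivity
    linarith

theorem avg_apply {n m : ℕ} [NeZero m] (I : Profile (n + 1) m) (j : Fin m) :
    avg m (n + 1) I j = (∑ i, I i j) / (n + 1) := by
  have h : ∑ k, (∑ i, I i k) / ((n + 1 : ℕ) : ℝ) = 1 := by
    have h1 : ∀ i, ∑ k, I i k = 1 := fun i => (I i).2.2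
    have : (n : ℝ) + 1 ≠ 0 := by positivity
    rw [← Finset.sum_div, Finset.sum_comm]
    simp [h1, this]
  obtain ⟨l, -, hl⟩ := Finset.exists_ne_zero_of_sum_ne_zero (h.trans_ne one_ne_zero)
  rw [avg, coordinateWise_apply hl, h, div_one]
  push_cast
  rfl

/-- Joining moves the average towards the agent: each coordinate difference is multiplied by a
factor of at most one. -/
theorem participation_avg (m : ℕ) [NeZero m] : Participation (avg m) := by
  rintro (_ | n) hn I i
  · omega
  refine Finset.sum_le_sum fun j _ => ?_
  rw [avg_apply, avg_apply, Fin.sum_univ_succAbove _ i]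
  push_cast
  set S := ∑ k, I (i.succAbove k) j
  have e : I i j - (I i j + S) / (n + 1 + 1) = (n + 1) / (n + 2) * (I i j - S / (n + 1)) := by
    field_simp
    ring
  rw [e, abs_mul]
  refine mul_le_of_le_one_left (abs_nonneg _) ?_
  rw [abs_of_nonneg (by positivity), div_le_one (by positivity)]
  linarith

/-! ### The maximum rule -/

theorem iSup_succAbove {n : ℕ} (v : Fin (n + 2) → ℝ) (i : Fin (n + 2)) :
    ⨆ i, v i = max (v i) (⨆ k, v (i.succAbove k)) := by
  have h1 := Finite.bddAbove_range v
  have h2 := Finite.bddAbove_range fun k => v (i.succAbove k)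
  refine le_antisymm (ciSup_le ((Fin.forall_iff_succAbove i).2 ⟨le_max_left _ _, fun k => ?_⟩))
    (max_le (le_ciSup h1 i) (ciSup_le fun k => le_ciSup h1 _))
  exact (le_ciSup h2 k).trans (le_max_right _ _)

theorem iInf_succAbove {n : ℕ} (v : Fin (n + 2) → ℝ) (i : Fin (n + 2)) :
    ⨅ i, v i = min (v i) (⨅ k, v (i.succAbove k)) := by
  have h1 := Finite.bddBelow_range v
  have h2 := Finite.bddBelow_range fun k => v (i.succAbove k)
  refine le_antisymm (le_min (ciInf_le h1 i) (le_ciInf fun k => ciInf_le h1 _))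
    (le_ciInf ((Fin.forall_iff_succAbove i).2 ⟨min_le_left _ _, fun k => ?_⟩))
  exact (min_le_right _ _).trans (ciInf_le h2 k)

theorem not_strategyproofFor_maxRule {k n : ℕ} (hn : 1 ≤ n) :
    ¬ StrategyproofFor (maxRule (k + 2)) (n + 1) := by
  obtain ⟨n, rfl⟩ : ∃ l, n = l + 1 := ⟨n - 1, by omega⟩
  -- The misreport gives maxima `(1, 1/2)`, normalized to the ideal `(2/3, 1/3)`; the truth gives
  -- `(1, 1/3)`, normalized to `(3/4, 1/4)`.
  refine not_strategyproofFor_of_cons (fun _ => pairDist 1 zero_le_one le_rfl)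
    (pairDist (2 / 3) (by norm_num) (by norm_num))
    (pairDist (1 / 2) (by norm_num) (by norm_num)) ?_ ?_
  · refine coordinateWise_eq (c := 3 / 2) (by norm_num) ?_
    refine Fin.cases ?_ (Fin.cases ?_ fun j => ?_) <;>
      rw [iSup_succAbove _ 0] <;> simp <;> norm_num
  · have : maxRule (k + 2) (n + 2) (Fin.cons (pairDist (2 / 3) (by norm_num) (by norm_num))
        (fun _ => pairDist 1 zero_le_one le_rfl) : Profile (n + 2) (k + 2)) =
        pairDist (3 / 4) (by norm_num) (by norm_num) := by
      refine coordinateWise_eq (c := 4 / 3) (by norm_num) ?_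
      refine Fin.cases ?_ (Fin.cases ?_ fun j => ?_) <;>
        rw [iSup_succAbove _ 0] <;> simp <;> norm_num
    rw [this]
    exact pairDist_ne _ _ _ _ (by norm_num)

theorem exists_pos_apply {m : ℕ} (x : Simplex m) : ∃ j, 0 < x j := by
  have hx : ∑ j, x j = 1 := x.2.2
  obtain ⟨j, -, hj⟩ := Finset.exists_ne_zero_of_sum_ne_zero (hx.trans_ne one_ne_zero)
  exact ⟨j, (show 0 ≤ x j from x.2.1 j).lt_of_ne hj.symm⟩

/-- The maxima sum to at least `1`, so an overshot candidate has a maximum strictly above the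
agent's score. It is due to somebody else and survives her removal, while the normalizing sum does
not increase. -/
theorem participation_maxRule (m : ℕ) [NeZero m] : Participation (maxRule m) := by
  rintro (_ | n) hn I i
  · omega
  set f : ∀ n : ℕ, (Fin n → ℝ) → ℝ := fun _ v => ⨆ i, v i with hfdef
  have hf : ∀ n v, (∀ i, 0 ≤ v i) → 0 ≤ f n v := fun _ _ hv => Real.iSup_nonneg hv
  have hle : ∀ {n : ℕ} (J : Profile (n + 1) m) i k, J i k ≤ f _ fun i => J i k :=
    fun J i k => le_ciSup (Finite.bddAbove_range fun i => J i k) i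
  have hsum : ∀ {n : ℕ} (J : Profile (n + 1) m), 1 ≤ ∑ k, f _ fun i => J i k := fun J =>
    (show ∑ k, J 0 k = 1 from (J 0).2.2).ge.trans (Finset.sum_le_sum fun k _ => hle J 0 k)
  set I' : Profile (n + 1) m := fun k => I (i.succAbove k) with hI'
  have hne : ∀ {n : ℕ} (J : Profile (n + 1) m), ∃ k, f _ (fun i => J i k) ≠ 0 := fun J =>
    (exists_pos_apply (J 0)).imp fun k hk => (hk.trans_le (hle J 0 k)).ne'
  obtain ⟨l, hl⟩ := hne I
  obtain ⟨l', hl'⟩ := hne I'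
  have hmono : ∀ j, f _ (fun i => I' i j) ≤ f _ fun i => I i j := fun j =>
    ciSup_le fun k => hle I _ j
  have h1 := hsum I
  have h1' := hsum I'
  have h2 : ∑ k, f _ (fun i => I' i k) ≤ ∑ k, f _ fun i => I i k :=
    Finset.sum_le_sum fun k _ => hmono k
  refine disutility_le_of_overshoot fun j hj => ?_
  rw [maxRule, coordinateWise_apply hl] at hj
  rw [maxRule, coordinateWise_apply hl, coordinateWise_apply hl']
  have h3 : I i j < f _ fun i => I i j := hj.trans_le (div_le_self (hf _ _ fun i => (I i).2.1 j) h1)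
  have h4 : f _ (fun i => I i j) = f _ fun i => I' i j := by
    have := iSup_succAbove (fun i => I i j) i
    change f _ (fun i => I i j) = max (I i j) (f _ fun i => I' i j) at this
    rcases max_choice (I i j) (f _ fun i => I' i j) with h | h
    · linarith
    · rw [this, h]
  change f _ (fun i => I i j) / (∑ k, f _ fun i => I i k) ≤
    f _ (fun i => I' i j) / ∑ k, f _ fun i => I' i k
  rw [h4]
  exact div_le_div_of_nonneg_left (hf _ _ fun i => (I' i).2.1 j) (by linarith) h2

/-! ### The minimum rule -/

theorem not_strategyproofFor_minRule {k n : ℕ} (hn : 1 ≤ n) :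
    ¬ StrategyproofFor (minRule (k + 2)) (n + 1) := by
  obtain ⟨n, rfl⟩ : ∃ l, n = l + 1 := ⟨n - 1, by omega⟩
  -- The misreport gives minima `(1/6, 1/2)`, normalized to the ideal `(1/4, 3/4)`; the truth gives
  -- `(1/4, 1/2)`, normalized to `(1/3, 2/3)`.
  refine not_strategyproofFor_of_cons (fun _ => pairDist (1 / 2) (by norm_num) (by norm_num))
    (pairDist (1 / 4) (by norm_num) (by norm_num))
    (pairDist (1 / 6) (by norm_num) (by norm_num)) ?_ ?_
  · refine coordinateWise_eq (c := 2 / 3) (by norm_num) ?_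
    refine Fin.cases ?_ (Fin.cases ?_ fun j => ?_) <;>
      rw [iInf_succAbove _ 0] <;> simp <;> norm_num
  · have : minRule (k + 2) (n + 2) (Fin.cons (pairDist (1 / 4) (by norm_num) (by norm_num))
        (fun _ => pairDist (1 / 2) (by norm_num) (by norm_num)) : Profile (n + 2) (k + 2)) =
        pairDist (1 / 3) (by norm_num) (by norm_num) := by
      refine coordinateWise_eq (c := 3 / 4) (by norm_num) ?_
      refine Fin.cases ?_ (Fin.cases ?_ fun j => ?_) <;>
        rw [iInf_succAbove _ 0] <;> simp <;> norm_num
    rw [this]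
    exact pairDist_ne _ _ _ _ (by norm_num)

/-- An agent does not profit from abstaining if, in every coordinate, the aggregated score moves
from hers towards the aggregated score without her, and the scores sum up to at most `1` relative
to the latter. -/
theorem disutility_coordinateWise_le {m : ℕ} [NeZero m] {f : ∀ n : ℕ, (Fin n → ℝ) → ℝ}
    {hf : ∀ n v, (∀ i, 0 ≤ v i) → 0 ≤ f n v} {n n' : ℕ} {I : Profile n m} {I' : Profile n' m}
    {s : Simplex m}
    (h0 : ∀ j, f n (fun i => I i j) = 0 ↔ f n' (fun i => I' i j) = 0 ∨ s j = 0)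
    (h : ∀ l l', f n (fun i => I i l) ≠ 0 → f n' (fun i => I' i l') ≠ 0 → ∀ j,
      coordinateWise f hf n I j < s j → coordinateWise f hf n' I' j ≤ coordinateWise f hf n I j) :
    disutility s (coordinateWise f hf n I) ≤ disutility s (coordinateWise f hf n' I') := by
  by_cases h1 : ∃ l, f n (fun i => I i l) ≠ 0
  · obtain ⟨l, hl⟩ := h1
    exact disutility_le_of_undershoot (h l l hl fun hl' => hl ((h0 l).2 (Or.inl hl')))
  · push Not at h1
    by_cases h2 : ∃ l, f n' (fun i => I' i l) ≠ 0
    · obtain ⟨l, hl⟩ := h2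
      -- If all scores vanish only once the agent joins, her support is disjoint from that of the
      -- outcome without her, which is thus already worst possible.
      refine (disutility_le_two _ _).trans_eq (disutility_eq_two_of_disjoint fun j => ?_).symm
      rw [coordinateWise_apply hl]
      rcases (h0 j).1 (h1 j) with h | h
      · exact Or.inr (by rw [h, zero_div])
      · exact Or.inl h
    · push Not at h2
      rw [coordinateWise_of_eq_zero h1, coordinateWise_of_eq_zero h2]

/-- Mirror image of the maximum rule: the minima sum to at most `1`, so at an undershot candidate
the minimum is due to somebody else, and removal can only enlarge the normalizing sum. -/
theorem participation_minRule (m : ℕ) [NeZero m] : Participation (minRule m) := by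
  rintro (_ | n) hn I i
  · omega
  set f : ∀ n : ℕ, (Fin n → ℝ) → ℝ := fun _ v => ⨅ i, v i with hfdef
  have hf : ∀ n v, (∀ i, 0 ≤ v i) → 0 ≤ f n v := fun _ _ hv => Real.iInf_nonneg hv
  set I' : Profile (n + 1) m := fun k => I (i.succAbove k) with hI'
  have hmin : ∀ j, f _ (fun i => I i j) = min (I i j) (f _ fun i => I' i j) := fun j =>
    iInf_succAbove (fun i => I i j) i
  have hn' : ∀ j, 0 ≤ f _ fun i => I' i j := fun j => hf _ _ fun i => (I' i).2.1 j
  have hs : ∀ j, 0 ≤ I i j := (I i).2.1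
  refine disutility_coordinateWise_le (f := f) (hf := hf) (fun j => ?_) fun l l' hl hl' j hj => ?_
  · rw [hmin]
    constructor
    · intro h
      rcases min_choice (I i j) (f _ fun i => I' i j) with h1 | h1
      · exact Or.inr (h1.symm.trans h)
      · exact Or.inl (h1.symm.trans h)
    · rintro (h | h)
      · rw [h, min_eq_right (hs j)]
      · rw [h, min_eq_left (hn' j)]
  · have h1 : ∑ k, f _ (fun i => I i k) ≤ 1 :=
      (Finset.sum_le_sum fun k _ => (hmin k).trans_le (min_le_left _ _)).trans_eq (I i).2.2
    have h2 : ∑ k, f _ (fun i => I i k) ≤ ∑ k, f _ fun i => I' i k :=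
      Finset.sum_le_sum fun k _ => (hmin k).trans_le (min_le_right _ _)
    have h3 := sum_pos_of_ne_zero hl hf
    rw [coordinateWise_apply hl] at hj ⊢
    rw [coordinateWise_apply hl']
    rw [div_lt_iff₀ h3] at hj
    have h4 : f _ (fun i => I i j) < I i j := hj.trans_le (mul_le_of_le_one_right (hs j) h1)
    have h5 : f _ (fun i => I i j) = f _ fun i => I' i j := by
      rcases min_choice (I i j) (f _ fun i => I' i j) with h | h
      · linarith [hmin j]
      · rw [hmin, h]
    rw [h5]
    exact div_le_div_of_nonneg_left (hn' j) h3 h2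

/-! ### The geometric mean rule -/

theorem not_strategyproofFor_geo {k n : ℕ} (hn : 1 ≤ n) :
    ¬ StrategyproofFor (geo (k + 2)) (n + 1) := by
  have hN : ((n : ℝ) + 1) ≠ 0 := by positivity
  have hp : (2 : ℝ) ^ (n + 1) > 0 := by positivity
  have hp1 : 1 / (1 + (2 : ℝ) ^ (n + 1)) ≤ 1 := by
    rw [div_le_one (by positivity)]; linarith
  -- The reported odds `1 : 2 ^ (n + 1)` become `1 : 2` after the `(n + 1)`-st root, matching the
  -- ideal `(1/3, 2/3)`. The true odds `1 : 2` would be flattened.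
  refine not_strategyproofFor_of_cons (fun _ => pairDist (1 / 2) (by norm_num) (by norm_num))
    (pairDist (1 / 3) (by norm_num) (by norm_num))
    (pairDist (1 / (1 + 2 ^ (n + 1))) (by positivity) hp1) ?_ ?_
  · set q : ℝ := 1 / (1 + 2 ^ (n + 1)) * (1 / 2) ^ n with hq
    have hq0 : 0 < q := by positivity
    refine coordinateWise_eq (c := 3 * q ^ (1 / ((n : ℝ) + 1))) (by positivity) ?_
    refine Fin.cases ?_ (Fin.cases ?_ fun j => ?_)
    · simp [Fin.prod_univ_succ, hq]
      ring
    · have e : (1 - 1 / (1 + (2 : ℝ) ^ (n + 1))) * (1 / 2) ^ n = 2 ^ (n + 1) * q := by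
        rw [hq]
        field_simp
        ring
      have e2 : ((2 : ℝ) ^ (n + 1) * q) ^ (1 / ((n : ℝ) + 1)) = 2 * q ^ (1 / ((n : ℝ) + 1)) := by
        rw [Real.mul_rpow (by positivity) hq0.le, ← Real.rpow_natCast, ← Real.rpow_mul (by norm_num)]
        congr 1
        push_cast
        rw [mul_one_div_cancel hN, Real.rpow_one]
      have e3 : (1 : ℝ) - 1 / 2 = 1 / 2 := by norm_num
      simp only [Fin.prod_univ_succ, Fin.cons_zero, Fin.cons_succ,
        Fin.succ_zero_eq_one, pairDist_one, Finset.prod_const,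
        Finset.card_univ, Fintype.card_fin, e3, Nat.cast_add, Nat.cast_one]
      rw [e, e2]
      ring
    · simp [Fin.prod_univ_succ, hN]
  · intro h
    set I : Profile (n + 1) (k + 2) := Fin.cons (pairDist (1 / 3) (by norm_num) (by norm_num))
      fun _ => pairDist (1 / 2) (by norm_num) (by norm_num) with hI
    have hN' : ((n + 1 : ℕ) : ℝ) ≠ 0 := by positivity
    have hroot : ∀ a : ℝ, 0 ≤ a → (a ^ (1 / ((n + 1 : ℕ) : ℝ))) ^ (n + 1) = a := fun a ha => by
      rw [← Real.rpow_natCast, ← Real.rpow_mul ha, one_div_mul_cancel hN', Real.rpow_one]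
    have p0 : ∏ i, I i 0 = 1 / 3 * (1 / 2) ^ n := by simp [Fin.prod_univ_succ, hI]
    have p1 : ∏ i, I i 1 = 2 / 3 * (1 / 2) ^ n := by
      simp [Fin.prod_univ_succ, hI]; norm_num [one_div_pow]
    set f : ∀ n : ℕ, (Fin n → ℝ) → ℝ := fun n v => (∏ i, v i) ^ (1 / (n : ℝ)) with hf
    have f0 : f (n + 1) (fun i => I i 0) = (1 / 3 * (1 / 2) ^ n : ℝ) ^ (1 / ((n + 1 : ℕ) : ℝ)) := by
      rw [← p0]
    have f1 : f (n + 1) (fun i => I i 1) = (2 / 3 * (1 / 2) ^ n : ℝ) ^ (1 / ((n + 1 : ℕ) : ℝ)) := by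
      rw [← p1]
    have hl : f (n + 1) (fun i => I i 0) ≠ 0 := by
      rw [f0]
      positivity
    have hf0 : ∀ n v, (∀ i, 0 ≤ v i) → 0 ≤ f n v := fun _ _ hv =>
      Real.rpow_nonneg (Finset.prod_nonneg fun i _ => hv i) _
    have hS := sum_pos_of_ne_zero hl hf0
    have q0 : _ = (1 / 3 : ℝ) := (coordinateWise_apply (hf := hf0) hl 0).symm.trans
      (congrArg (fun x : Simplex (k + 2) => x 0) h)
    have q1 : _ = (1 - 1 / 3 : ℝ) := (coordinateWise_apply (hf := hf0) hl 1).symm.trans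
      (congrArg (fun x : Simplex (k + 2) => x 1) h)
    rw [div_eq_iff hS.ne', f0] at q0
    rw [div_eq_iff hS.ne', f1] at q1
    have q2 : (2 / 3 * (1 / 2) ^ n : ℝ) ^ (1 / ((n + 1 : ℕ) : ℝ)) =
        2 * (1 / 3 * (1 / 2) ^ n : ℝ) ^ (1 / ((n + 1 : ℕ) : ℝ)) := by
      rw [q0, q1]; ring
    have q3 := congrArg (· ^ (n + 1)) q2
    simp only [mul_pow] at q3
    rw [hroot _ (by positivity), ← mul_pow] at q3
    rw [mul_pow, hroot _ (by positivity)] at q3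
    have q4 : (0 : ℝ) < (1 / 2) ^ n := by positivity
    have q5 : (2 : ℝ) ^ (n + 1) = 2 := by
      have : (2 : ℝ) ^ (n + 1) * (1 / 3 * (1 / 2) ^ n) = 2 * (1 / 3 * (1 / 2) ^ n) := by
        rw [← q3]; ring
      exact mul_right_cancel₀ (by positivity) this
    have q6 : (2 : ℝ) ^ 2 ≤ 2 ^ (n + 1) := pow_le_pow_right₀ (by norm_num) (by omega)
    norm_num [q5] at q6

theorem geo_score_succAbove {n : ℕ} (v : Fin (n + 2) → ℝ) (hv : ∀ i, 0 ≤ v i) (i : Fin (n + 2)) :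
    (∏ i, v i) ^ (1 / ((n + 2 : ℕ) : ℝ)) = v i ^ (1 / ((n : ℝ) + 2)) *
      ((∏ k, v (i.succAbove k)) ^ (1 / ((n + 1 : ℕ) : ℝ))) ^ (1 - 1 / ((n : ℝ) + 2)) := by
  have h : 0 ≤ ∏ k, v (i.succAbove k) := Finset.prod_nonneg fun k _ => hv _
  have h1 : (n : ℝ) + 1 ≠ 0 := by positivity
  have h2 : (n : ℝ) + 2 ≠ 0 := by positivity
  rw [Fin.prod_univ_succAbove _ i, Real.mul_rpow (hv i) h, ← Real.rpow_mul h]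
  push_cast
  congr 2
  field_simp
  ring

/-- Up to a common factor, the new outcome is the weighted geometric mean of the agent's ideal and
the old outcome. By AM-GM these means sum to at most one, so normalizing only raises them. An
undershot coordinate of the new outcome is thus at least the old one. -/
theorem participation_geo (m : ℕ) [NeZero m] : Participation (geo m) := by
  rintro (_ | n) hn I i
  · omega
  set f : ∀ n : ℕ, (Fin n → ℝ) → ℝ := fun n v => (∏ i, v i) ^ (1 / (n : ℝ)) with hfdef
  have hf : ∀ n v, (∀ i, 0 ≤ v i) → 0 ≤ f n v := fun _ _ hv =>
    Real.rpow_nonneg (Finset.prod_nonneg fun i _ => hv i) _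
  set I' : Profile (n + 1) m := fun k => I (i.succAbove k) with hI'
  set α : ℝ := 1 / ((n : ℝ) + 2) with hα
  have hα0 : 0 < α := by positivity
  have hα1 : α < 1 := by rw [hα, div_lt_one (by positivity)]; linarith [n.cast_nonneg (α := ℝ)]
  have hprod : ∀ j, f _ (fun i => I i j) = I i j ^ α * (f _ fun i => I' i j) ^ (1 - α) := fun j =>
    geo_score_succAbove (fun i => I i j) (fun i => (I i).2.1 j) i
  have hn' : ∀ j, 0 ≤ f _ fun i => I' i j := fun j => hf _ _ fun i => (I' i).2.1 j
  have hs : ∀ j, 0 ≤ I i j := (I i).2.1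
  refine disutility_coordinateWise_le (f := f) (hf := hf) (fun j => ?_) fun l l' hl hl' j hj => ?_
  · rw [hprod, mul_eq_zero, Real.rpow_eq_zero (hs j) hα0.ne', Real.rpow_eq_zero (hn' j)
      (by linarith), or_comm]
  · have h1 := sum_pos_of_ne_zero hl hf
    have h2 := sum_pos_of_ne_zero hl' hf
    have hx := fun j => coordinateWise_apply (hf := hf) hl j
    have hx' := fun j => coordinateWise_apply (hf := hf) hl' j
    set x := coordinateWise f hf (n + 1 + 1) I
    set x' := coordinateWise f hf (n + 1) I'
    set G := ∑ k, f _ fun i => I i k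
    set G' := ∑ k, f _ fun i => I' i k
    have hx0 : ∀ j, 0 ≤ x' j := x'.2.1
    have h3 : ∀ j, f _ (fun i => I i j) = G' ^ (1 - α) * (I i j ^ α * x' j ^ (1 - α)) := fun j => by
      rw [hprod, ← div_mul_cancel₀ (f _ fun i => I' i j) h2.ne', ← hx',
        Real.mul_rpow (hx0 j) h2.le]
      ring
    have h4 : G ≤ G' ^ (1 - α) := by
      have h5 : G = G' ^ (1 - α) * ∑ j, I i j ^ α * x' j ^ (1 - α) := by
        rw [Finset.mul_sum]
        exact Finset.sum_congr rfl fun j _ => h3 j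
      have h6 : ∑ j, I i j ^ α * x' j ^ (1 - α) ≤ ∑ j, (α * I i j + (1 - α) * x' j) :=
        Finset.sum_le_sum fun j _ => Real.geom_mean_le_arith_mean2_weighted hα0.le (by linarith)
          (hs j) (hx0 j) (by ring)
      have h7 : ∑ j, I i j = 1 := (I i).2.2
      have h8 : ∑ j, x' j = 1 := x'.2.2
      rw [Finset.sum_add_distrib, ← Finset.mul_sum, ← Finset.mul_sum, h7, h8] at h6
      rw [h5]
      exact mul_le_of_le_one_right (by positivity) (by linarith)
    have h5 : I i j ^ α * x' j ^ (1 - α) ≤ x j := by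
      rw [hx, h3, le_div_iff₀ h1, mul_comm]
      exact mul_le_mul_of_nonneg_right h4
        (mul_nonneg (Real.rpow_nonneg (hs j) _) (Real.rpow_nonneg (hx0 j) _))
    have hpow : ∀ a : ℝ, 0 ≤ a → a ^ α * a ^ (1 - α) = a := fun a ha => by
      rw [← Real.rpow_add_of_nonneg ha hα0.le (by linarith), add_sub_cancel, Real.rpow_one]
    refine le_trans ?_ h5
    by_contra! h6
    -- A geometric mean is at least the smaller of its two arguments, both of which are supposed to
    -- exceed `x j`.
    rcases le_total (x' j) (I i j) with h7 | h7
    · have : x' j ^ α * x' j ^ (1 - α) ≤ I i j ^ α * x' j ^ (1 - α) :=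
        mul_le_mul_of_nonneg_right (Real.rpow_le_rpow (hx0 j) h7 hα0.le)
          (Real.rpow_nonneg (hx0 j) _)
      rw [hpow _ (hx0 j)] at this
      linarith
    · have : I i j ^ α * I i j ^ (1 - α) ≤ I i j ^ α * x' j ^ (1 - α) :=
        mul_le_mul_of_nonneg_left (Real.rpow_le_rpow (hs j) h7 (by linarith))
          (Real.rpow_nonneg (hs j) _)
      rw [hpow _ (hs j)] at this
      linarith

/-! ### Egalitarian rules -/

theorem nthLargest_antitone_of_lt {M : Multiset ℝ} {k l : ℕ} (hkl : k ≤ l) (hl : l < M.card) :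
    nthLargest M l ≤ nthLargest M k :=
  (le_nthLargest_iff (hkl.trans_lt hl) _).2
    (hkl.trans_lt ((le_nthLargest_iff hl _).1 le_rfl))

theorem sum_nthLargest {M : Multiset ℝ} {n : ℕ} (hM : M.card = n) (g : ℝ → ℝ) :
    ∑ k : Fin n, g (nthLargest M k) = (M.map g).sum := by
  have hl : (M.sort (· ≥ ·)).length = n := (Multiset.length_sort (· ≥ ·)).trans hM
  subst hl
  conv_rhs => rw [← Multiset.sort_eq M (· ≥ ·)]
  rw [Multiset.map_coe, Multiset.sum_coe, ← Fin.sum_univ_fun_getElem]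
  refine Finset.sum_congr rfl fun k _ => ?_
  rw [nthLargest, List.getD_eq_getElem _ _ k.2]

theorem card_disutilities {n m : ℕ} (I : Profile n m) (x : Simplex m) :
    (Finset.univ.val.map fun i => disutility (I i) x).card = n := by
  simp

theorem sum_disutilityVector {n m : ℕ} (I : Profile n m) (x : Simplex m) (g : ℝ → ℝ) :
    ∑ k, g (disutilityVector I x k) = ∑ i, g (disutility (I i) x) := by
  have := sum_nthLargest (card_disutilities I x) g
  rw [Multiset.map_map] at this
  exact this

theorem disutilityVector_antitone {n m : ℕ} (I : Profile n m) (x : Simplex m) :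
    Antitone (disutilityVector I x) := fun _ l h =>
  nthLargest_antitone_of_lt h (by rw [card_disutilities]; exact l.2)

/-- Once `exp (T * (v k - w k))` exceeds `n`, the single term of `v` at the first difference `k`
outweighs the whole remaining tail of `w`, whose entries are at most `w k`. -/
theorem LexGT.eventually_sum_exp_lt {n : ℕ} {v w : Fin n → ℝ} (h : LexGT v w) (hw : Antitone w) :
    ∀ᶠ T : ℝ in Filter.atTop, ∑ k, Real.exp (T * w k) < ∑ k, Real.exp (T * v k) := by
  obtain ⟨k, h1, h2⟩ := h
  have hlim : Filter.Tendsto (fun T : ℝ => Real.exp (T * (v k - w k))) Filter.atTop Filter.atTop :=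
    Real.tendsto_exp_atTop.comp (Filter.tendsto_id.atTop_mul_const (sub_pos.2 h2))
  filter_upwards [hlim.eventually_gt_atTop (n : ℝ), Filter.eventually_ge_atTop 0] with T hT hT0
  have e : ∀ u : Fin n → ℝ, ∑ l, Real.exp (T * u l) =
      ∑ l ∈ Finset.Iio k, Real.exp (T * u l) + ∑ l ∈ Finset.Ici k, Real.exp (T * u l) := by
    intro u
    rw [← Finset.sum_union]
    · congr 1
      ext l
      simpa using lt_or_ge l k
    · rw [Finset.disjoint_left]
      intro l h3 h4
      exact absurd (Finset.mem_Iio.1 h3) (not_lt.2 (Finset.mem_Ici.1 h4))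
  rw [e w, e v]
  refine add_lt_add_of_le_of_lt (Finset.sum_le_sum fun l hl => ?_) ?_
  · rw [h1 l (Finset.mem_Iio.1 hl)]
  · calc ∑ l ∈ Finset.Ici k, Real.exp (T * w l)
        ≤ ∑ l ∈ Finset.Ici k, Real.exp (T * w k) := Finset.sum_le_sum fun l hl =>
          Real.exp_le_exp.2 (mul_le_mul_of_nonneg_left (hw (Finset.mem_Ici.1 hl)) hT0)
      _ ≤ n * Real.exp (T * w k) := by
          rw [Finset.sum_const, nsmul_eq_mul]
          gcongr
          exact (Finset.card_le_univ _).trans_eq (Fintype.card_fin n)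
      _ < Real.exp (T * (v k - w k)) * Real.exp (T * w k) :=
          mul_lt_mul_of_pos_right hT (Real.exp_pos _)
      _ = Real.exp (T * v k) := by rw [← Real.exp_add]; ring_nf
      _ ≤ ∑ l ∈ Finset.Ici k, Real.exp (T * v l) :=
          Finset.single_le_sum (f := fun l => Real.exp (T * v l))
            (fun l _ => (Real.exp_pos _).le) (Finset.mem_Ici.2 le_rfl)

theorem IsEgalOutcome.eventually_sum_exp_le {n m : ℕ} {I : Profile n m} {x : Simplex m}
    (hx : IsEgalOutcome I x) (y : Simplex m) : ∀ᶠ T : ℝ in Filter.atTop,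
      ∑ i, Real.exp (T * disutility (I i) x) ≤ ∑ i, Real.exp (T * disutility (I i) y) := by
  have h : ∀ᶠ T : ℝ in Filter.atTop, ∑ k, Real.exp (T * disutilityVector I x k) ≤
      ∑ k, Real.exp (T * disutilityVector I y k) := by
    rcases hx y with h | h
    · exact Filter.Eventually.of_forall fun T => by rw [h]
    · exact (h.eventually_sum_exp_lt (disutilityVector_antitone I x)).mono fun T hT => hT.le
  filter_upwards [h] with T hT
  rwa [sum_disutilityVector I x fun d => Real.exp (T * d),
    sum_disutilityVector I y fun d => Real.exp (T * d)] at hT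

/-- For a common large `T`, each outcome is optimal for its own exponential sum against the other.
Adding the inequalities leaves only the abstaining agent's two terms. -/
theorem participation_of_isEgalRule {m : ℕ} {F : AggregationRule m} (hF : IsEgalRule F) :
    Participation F := by
  intro n _ I i
  by_contra! hlt
  obtain ⟨T, ⟨h1, h2⟩, h3⟩ := (((hF (n + 1) I).eventually_sum_exp_le
    (F n fun k => I (i.succAbove k))).and ((hF n fun k => I (i.succAbove k)).eventually_sum_exp_le
    (F (n + 1) I))).and (Filter.eventually_gt_atTop 0) |>.exists
  rw [Fin.sum_univ_succAbove _ i, Fin.sum_univ_succAbove _ i] at h1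
  have := Real.exp_lt_exp.2 (mul_lt_mul_of_pos_left hlt h3)
  linarith

/-- The first entry of the sorted vector is the largest disutility, so a leximin outcome minimizes
the maximum. The manipulation below uses nothing else, hence works for every tie-breaking. -/
theorem IsEgalOutcome.disutility_le {n m : ℕ} {I : Profile n m} {x : Simplex m}
    (hx : IsEgalOutcome I x) {y : Simplex m} {c : ℝ} (hy : ∀ i, disutility (I i) y ≤ c)
    (i : Fin n) : disutility (I i) x ≤ c := by
  obtain ⟨n, rfl⟩ : ∃ l, n = l + 1 := ⟨n - 1, by have := i.2; omega⟩
  have h0 : disutilityVector I x 0 ≤ disutilityVector I y 0 := by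
    rcases hx y with h | ⟨k, h1, h2⟩
    · rw [h]
    · rcases (Fin.zero_le k).eq_or_lt with h | h
      · rw [h]; exact h2.le
      · exact (h1 0 h).ge
  have h1 : disutilityVector I y 0 ≤ c := by
    refine (nthLargest_le_iff (by simp) c).2 (le_of_eq (Multiset.countP_eq_zero.2 fun a ha => ?_))
    obtain ⟨k, -, rfl⟩ := Multiset.mem_map.1 ha
    exact not_lt.2 (hy k)
  refine le_trans ((le_nthLargest_iff (by simp) _).2 (Multiset.countP_pos.2 ⟨_, ?_, le_rfl⟩))
    (h0.trans h1)
  exact Multiset.mem_map_of_mem (fun i => disutility (I i) x) (Finset.mem_univ_val i)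

theorem disutility_pairDist {k : ℕ} {a b : ℝ} (ha0 : 0 ≤ a) (ha1 : a ≤ 1) (hb0 : 0 ≤ b)
    (hb1 : b ≤ 1) : disutility (pairDist a ha0 ha1 : Simplex (k + 2)) (pairDist b hb0 hb1) =
      2 * |a - b| := by
  simp only [disutility, Fin.sum_univ_succ, Fin.succ_zero_eq_one, pairDist_zero, pairDist_one,
    pairDist_succ_succ, sub_self, abs_zero, Finset.sum_const_zero]
  rw [show 1 - a - (1 - b) = -(a - b) by ring, abs_neg]
  ring

theorem le_disutility_vertex {m : ℕ} {s x : Simplex m} {l : Fin m} (hs : s l = 1) :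
    2 * (1 - x l) ≤ disutility s x := by
  have hsum : ∑ j, s j = 1 := s.2.2
  have hxum : ∑ j, x j = 1 := x.2.2
  rw [disutility_comm, disutility_eq_two_mul_sum_pos]
  have := Finset.single_le_sum (f := fun j => max (s j - x j) 0) (fun j _ => le_max_right _ _)
    (Finset.mem_univ l)
  have h := le_max_left (s l - x l) 0
  linarith

theorem not_strategyproofFor_of_isEgalRule {k n : ℕ} (hn : 1 ≤ n) {F : AggregationRule (k + 2)}
    (hF : IsEgalRule F) : ¬ StrategyproofFor F (n + 1) := by
  obtain ⟨n, rfl⟩ : ∃ l, n = l + 1 := ⟨n - 1, by omega⟩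
  refine not_strategyproofFor_of_cons (fun _ => pairDist 1 zero_le_one le_rfl)
    (pairDist (1 / 2) (by norm_num) (by norm_num)) (pairDist 0 le_rfl zero_le_one) ?_ ?_
  · have h := (hF _ (Fin.cons (pairDist 0 le_rfl zero_le_one)
      (fun _ => pairDist 1 zero_le_one le_rfl) : Profile (n + 2) (k + 2))).disutility_le
      (y := pairDist (1 / 2) (by norm_num) (by norm_num)) (c := 1) (by
        refine Fin.cases ?_ fun i => ?_
        · rw [Fin.cons_zero, disutility_pairDist]; norm_num [abs_of_nonneg]
        · rw [Fin.cons_succ, disutility_pairDist]; norm_num [abs_of_nonneg])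
    set x := F (n + 2) (Fin.cons (pairDist 0 le_rfl zero_le_one)
      (fun _ => pairDist 1 zero_le_one le_rfl) : Profile (n + 2) (k + 2))
    -- Agents at two opposite vertices, both with disutility at most `1`, force mass at least `1/2`
    -- on each of the two candidates, hence determine the outcome.
    have h1 := (le_disutility_vertex (x := x) (l := 1) (by simp)).trans (h 0)
    have h2 := (le_disutility_vertex (x := x) (l := 0) (by simp)).trans (h (Fin.succ 0))
    have hx : ∑ j, x j = 1 := x.2.2
    have hx0 : ∀ j, 0 ≤ x j := x.2.1
    have h3 : 0 ≤ ∑ j : Fin k, x j.succ.succ := Finset.sum_nonneg fun j _ => hx0 _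
    rw [Fin.sum_univ_succ, Fin.sum_univ_succ, Fin.succ_zero_eq_one] at hx
    have h4 : ∑ j : Fin k, x j.succ.succ = 0 := by linarith
    ext j
    refine Fin.cases ?_ (Fin.cases ?_ fun j => ?_) j
    · change x 0 = 1 / 2
      linarith
    · change x 1 = 1 - 1 / 2
      linarith
    · exact (Finset.sum_eq_zero_iff_of_nonneg fun j _ => hx0 _).1 h4 j (Finset.mem_univ j)
  · intro he
    -- Under the truth `(3/4, 1/4)` costs everyone at most `1/2`, whereas the manipulator's ideal
    -- would cost the others `1`.
    have h := (hF _ (Fin.cons (pairDist (1 / 2) (by norm_num) (by norm_num))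
      (fun _ => pairDist 1 zero_le_one le_rfl) : Profile (n + 2) (k + 2))).disutility_le
      (y := pairDist (3 / 4) (by norm_num) (by norm_num)) (c := 1 / 2) (by
        refine Fin.cases ?_ fun i => ?_
        · rw [Fin.cons_zero, disutility_pairDist, abs_of_nonpos (by norm_num)]; norm_num
        · rw [Fin.cons_succ, disutility_pairDist]; norm_num [abs_le]) (Fin.succ 0)
    rw [he, Fin.cons_succ, disutility_pairDist] at h
    norm_num [abs_of_nonneg] at h

/-! ### The median rule -/

theorem countP_replicate {α : Type*} (p : α → Prop) [DecidablePred p] (n : ℕ) (a : α) :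
    (Multiset.replicate n a).countP p = if p a then n else 0 := by
  induction n with
  | zero => simp
  | succ n ih =>
    rw [Multiset.replicate_succ, Multiset.countP_cons, ih]
    split_ifs <;> rfl

theorem nthLargest_eq {M : Multiset ℝ} {k : ℕ} {a : ℝ} (h1 : M.countP (a < ·) ≤ k)
    (h2 : k < M.countP (a ≤ ·)) : nthLargest M k = a := by
  have hk : k < M.card := h2.trans_le (Multiset.countP_le_card _ _)
  exact le_antisymm ((nthLargest_le_iff hk a).2 h1) ((le_nthLargest_iff hk a).2 h2)

theorem median_of_card_odd {M : Multiset ℝ} {h : ℕ} (hM : M.card = 2 * h + 1) :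
    median M = nthLargest M h := by
  rw [median, hM, show (2 * h + 1 - 1) / 2 = h by omega, show (2 * h + 1) / 2 = h by omega]
  ring

theorem median_of_card_even {M : Multiset ℝ} {h : ℕ} (hM : M.card = 2 * h + 2) :
    median M = (nthLargest M h + nthLargest M (h + 1)) / 2 := by
  rw [median, hM, show (2 * h + 2 - 1) / 2 = h by omega, show (2 * h + 2) / 2 = h + 1 by omega]

theorem nthLargest_le_of_cons {s : ℝ} {R : Multiset ℝ} {k : ℕ} (hk : k ≤ R.card)
    (h : s < nthLargest (s ::ₘ R) k) :
    k < R.card ∧ nthLargest (s ::ₘ R) k ≤ nthLargest R k := by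
  have h1 := (le_nthLargest_iff (M := s ::ₘ R) (k := k) (by simpa [Nat.lt_succ_iff] using hk) _).1
    le_rfl
  rw [Multiset.countP_cons, if_neg (not_le.2 h)] at h1
  have h2 : k < R.card := h1.trans_le (Multiset.countP_le_card _ _)
  exact ⟨h2, (le_nthLargest_iff h2 _).2 h1⟩

theorem nthLargest_le_cons (s : ℝ) {R : Multiset ℝ} {k : ℕ} (hk : k < R.card) :
    nthLargest R k ≤ nthLargest (s ::ₘ R) k := by
  rw [le_nthLargest_iff (by rw [Multiset.card_cons]; omega)]
  exact ((le_nthLargest_iff hk _).1 le_rfl).trans_le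
    (Multiset.countP_le_of_le _ (Multiset.le_cons_self _ _))

theorem median_le_median_replace {s s' : ℝ} {R : Multiset ℝ} (hR : Even R.card)
    (h : s < median (s ::ₘ R)) : median (s ::ₘ R) ≤ median (s' ::ₘ R) := by
  obtain ⟨l, hl⟩ := hR
  have hc : ∀ a, (a ::ₘ R).card = 2 * l + 1 := fun a => by rw [Multiset.card_cons]; omega
  rw [median_of_card_odd (hc s)] at h ⊢
  rw [median_of_card_odd (hc s')]
  obtain ⟨h1, h2⟩ := nthLargest_le_of_cons (by omega) h
  exact h2.trans (nthLargest_le_cons s' h1)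

/-- An entry of `s ::ₘ R` above `s` is at most the entry of the same rank in `R`. For even `R` the
lower middle entry of `R` already suffices; for odd `R` the upper middle entry of `s ::ₘ R`
dominates its median and exceeds `s`. -/
theorem median_le_median_remove {s : ℝ} {R : Multiset ℝ} (hR : 0 < R.card)
    (h : s < median (s ::ₘ R)) : median (s ::ₘ R) ≤ median R := by
  rcases Nat.even_or_odd' R.card with ⟨l, hl | hl⟩
  · obtain ⟨l, rfl⟩ : ∃ k, l = k + 1 := ⟨l - 1, by omega⟩
    rw [median_of_card_odd (h := l + 1) (by rw [Multiset.card_cons]; omega)] at h ⊢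
    rw [median_of_card_even (h := l) (by omega)]
    obtain ⟨h1, h2⟩ := nthLargest_le_of_cons (by omega) h
    have := nthLargest_antitone_of_lt (Nat.le_succ l) h1
    simp only [Nat.succ_eq_add_one] at this
    linarith
  · rw [median_of_card_even (h := l) (by rw [Multiset.card_cons]; omega)] at h ⊢
    rw [median_of_card_odd (h := l) (by omega)]
    have := nthLargest_antitone_of_lt (M := s ::ₘ R) (Nat.le_succ l)
      (by rw [Multiset.card_cons]; omega)
    simp only [Nat.succ_eq_add_one] at this
    have := (nthLargest_le_of_cons (s := s) (R := R) (k := l) (by omega) (by linarith)).2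
    linarith

theorem nthLargest_map_one_sub {M : Multiset ℝ} {k : ℕ} (hk : k < M.card) :
    nthLargest (M.map fun a => 1 - a) k = 1 - nthLargest M (M.card - 1 - k) := by
  refine eq_of_forall_le_iff fun c => ?_
  rw [le_nthLargest_iff (by simpa using hk), Multiset.countP_map, le_sub_comm,
    nthLargest_le_iff (by omega), ← Multiset.countP_eq_card_filter]
  have h := Multiset.card_eq_countP_add_countP (fun a => c ≤ 1 - a) M
  have e : M.countP (fun a => ¬ c ≤ 1 - a) = M.countP (1 - c < ·) :=
    Multiset.countP_congr rfl fun a _ => by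
      rw [eq_iff_iff, not_le]
      constructor <;> intro h <;> linarith
  rw [e] at h
  omega

theorem median_map_one_sub {M : Multiset ℝ} (hM : 0 < M.card) :
    median (M.map fun a => 1 - a) = 1 - median M := by
  rw [median, median, Multiset.card_map, nthLargest_map_one_sub (by omega),
    nthLargest_map_one_sub (by omega), show M.card - 1 - (M.card - 1) / 2 = M.card / 2 by omega,
    show M.card - 1 - M.card / 2 = (M.card - 1) / 2 by omega]
  ring

/-- The second candidate's scores are the first one's reflected by `a ↦ 1 - a`, and medians commute
with the reflection. They sum to one, so normalization is void. -/
theorem med_two_apply {n : ℕ} [NeZero 2] (hn : 0 < n) (I : Profile n 2) (j : Fin 2) :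
    med 2 n I j = median (scores I j) := by
  have hs : scores I 1 = (scores I 0).map fun a => 1 - a := by
    unfold scores
    rw [Multiset.map_map]
    refine Multiset.map_congr rfl fun i _ => ?_
    have : ∑ j, I i j = 1 := (I i).2.2
    rw [Fin.sum_univ_two] at this
    rw [Function.comp_apply]
    linarith
  have hsum : ∑ j, median (scores I j) = 1 := by
    rw [Fin.sum_univ_two, hs, median_map_one_sub (by rw [card_scores]; exact hn)]
    ring
  obtain ⟨l, -, hl⟩ := Finset.exists_ne_zero_of_sum_ne_zero (hsum.trans_ne one_ne_zero)
  rw [med, coordinateWise_apply (l := l) hl]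
  exact (congrArg _ hsum).trans (div_one _)

theorem strategyproofFor_med_two [NeZero 2] {n : ℕ} (hn : Odd n) :
    StrategyproofFor (med 2) n := by
  obtain ⟨h, rfl⟩ := hn
  rw [strategyproofFor_succ_iff]
  intro I I' i hII
  refine disutility_le_of_overshoot fun j hj => ?_
  have hI' := scores_succAbove I' i j
  rw [← hII] at hI'
  rw [med_two_apply (by omega), scores_succAbove I i] at hj ⊢
  rw [med_two_apply (by omega), hI']
  exact median_le_median_replace (by rw [card_scores]; exact even_two_mul h) hj

theorem participation_med_two [NeZero 2] : Participation (med 2) := by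
  intro n hn I i
  refine disutility_le_of_overshoot fun j hj => ?_
  rw [med_two_apply (by omega), scores_succAbove I i] at hj ⊢
  rw [med_two_apply (by omega)]
  exact median_le_median_remove (by rw [card_scores]; omega) hj

/-! ### Counterexamples for the median rule -/

/-- The profile consisting of `p` copies of `A` and `q` copies of `B`. -/
def blocks {m : ℕ} (p q : ℕ) (A B : Simplex m) : Profile (p + q) m :=
  Fin.append (fun _ => A) fun _ => B

theorem scores_blocks {m : ℕ} (p q : ℕ) (A B : Simplex m) (j : Fin m) :
    scores (blocks p q A B) j = Multiset.replicate p (A j) + Multiset.replicate q (B j) := by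
  have : (fun i => blocks p q A B i j) = Fin.append (fun _ => A j) fun _ => B j := by
    funext i
    refine Fin.addCases (fun i => ?_) (fun i => ?_) i <;> simp [blocks]
  rw [scores, this, Fin.univ_val_map, List.ofFn_fin_append, List.ofFn_const, List.ofFn_const]
  rfl

theorem scores_cons {n m : ℕ} (s : Simplex m) (R : Profile n m) (j : Fin m) :
    scores (Fin.cons s R : Profile (n + 1) m) j = s j ::ₘ scores R j :=
  scores_succAbove (Fin.cons s R : Profile (n + 1) m) 0 j

theorem median_cons_blocks_odd {h : ℕ} {s x y : ℝ} (hx : s ≤ x) (hy : y ≤ s) :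
    median (s ::ₘ (Multiset.replicate h x + Multiset.replicate h y)) = s := by
  rw [median_of_card_odd (h := h) (by simp; ring)]
  refine nthLargest_eq ?_ ?_ <;>
    simp only [Multiset.countP_cons, Multiset.countP_add, countP_replicate] <;>
    split_ifs <;> first | omega | linarith

theorem median_cons_blocks_const {h : ℕ} (hh : 1 ≤ h) {s x : ℝ} :
    median (s ::ₘ (Multiset.replicate h x + Multiset.replicate h x)) = x := by
  rw [median_of_card_odd (h := h) (by simp; ring)]
  refine nthLargest_eq ?_ ?_ <;>
    simp only [Multiset.countP_cons, Multiset.countP_add, countP_replicate] <;>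
    split_ifs <;> first | omega | linarith

theorem median_cons_blocks_even {h : ℕ} {s x y : ℝ} (hx : s ≤ x) (hy : y ≤ s) :
    median (s ::ₘ (Multiset.replicate (h + 1) x + Multiset.replicate h y)) = (x + s) / 2 := by
  rw [median_of_card_even (h := h) (by simp; ring)]
  congr 2
  all_goals
    refine nthLargest_eq ?_ ?_ <;>
    simp only [Multiset.countP_cons, Multiset.countP_add, countP_replicate] <;>
    split_ifs <;> first | omega | linarith

theorem median_cons_blocks_even' {h : ℕ} {s x y : ℝ} (hx : x ≤ s) (hy : s ≤ y) :
    median (s ::ₘ (Multiset.replicate (h + 1) x + Multiset.replicate h y)) = (x + s) / 2 := by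
  rw [median_of_card_even (h := h) (by simp; ring), add_comm]
  congr 2
  all_goals
    refine nthLargest_eq ?_ ?_ <;>
    simp only [Multiset.countP_cons, Multiset.countP_add, countP_replicate] <;>
    split_ifs <;> first | omega | linarith

theorem med_eq {n m : ℕ} [NeZero m] {I : Profile n m} {x : Simplex m} {c : ℝ} (hc : c ≠ 0)
    (h : ∀ j, median (scores I j) = c * x j) : med m n I = x :=
  coordinateWise_eq hc h

/-- With `h + 1` agents at one vertex and `h` at another, the middle entries are the manipulator's
score and the majority's. The outcome is halfway between her report and the majority vertex, so she
exaggerates. -/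
theorem not_strategyproofFor_med_even {k h : ℕ} :
    ¬ StrategyproofFor (med (k + 2)) (h + 1 + h + 1) := by
  have key : ∀ (a : ℝ) (h0 : 0 ≤ a) (h1 : a ≤ 1), med (k + 2) (h + 1 + h + 1)
      (Fin.cons (pairDist a h0 h1) (blocks (h + 1) h (pairDist 1 zero_le_one le_rfl)
        (pairDist 0 le_rfl zero_le_one)) : Profile (h + 1 + h + 1) (k + 2)) =
      pairDist ((1 + a) / 2) (by linarith) (by linarith) := by
    intro a h0 h1
    refine med_eq one_ne_zero fun j => ?_
    rw [scores_cons, scores_blocks]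
    refine Fin.cases ?_ (Fin.cases ?_ fun j => ?_) j
    · rw [pairDist_zero, pairDist_zero, pairDist_zero, pairDist_zero,
        median_cons_blocks_even h1 h0, one_mul]
    · rw [Fin.succ_zero_eq_one, pairDist_one, pairDist_one, pairDist_one, pairDist_one,
        median_cons_blocks_even' (by linarith) (by linarith)]
      ring
    · rw [pairDist_succ_succ, pairDist_succ_succ, pairDist_succ_succ, pairDist_succ_succ,
        median_cons_blocks_even le_rfl le_rfl]
      ring
  refine not_strategyproofFor_of_cons _ (pairDist (1 / 2) (by norm_num) (by norm_num))
    (pairDist 0 le_rfl zero_le_one) ((key _ _ _).trans ?_) ((key _ _ _).trans_ne ?_)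
  · ext j
    norm_num
  · exact pairDist_ne _ _ _ _ (by norm_num)

/-- The distribution of the mass `1` over the first three candidates. -/
def tripleDist {k : ℕ} (a b : ℝ) (h0 : 0 ≤ a) (h1 : 0 ≤ b) (h2 : a + b ≤ 1) : Simplex (k + 3) :=
  ⟨Fin.cons a (Fin.cons b (Fin.cons (1 - a - b) 0)), by
    have h3 : 0 ≤ 1 - a - b := by linarith
    exact Fin.cases h0 (Fin.cases h1 (Fin.cases h3 fun _ => le_rfl)), by
    simp [Fin.sum_univ_succ]⟩

section TripleDist

variable {k : ℕ} {a b : ℝ} (h0 : 0 ≤ a) (h1 : 0 ≤ b) (h2 : a + b ≤ 1)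

theorem tripleDist_zero : (tripleDist a b h0 h1 h2 : Simplex (k + 3)) 0 = a := rfl

theorem tripleDist_one : (tripleDist a b h0 h1 h2 : Simplex (k + 3)) (Fin.succ 0) = b := rfl

theorem tripleDist_two :
    (tripleDist a b h0 h1 h2 : Simplex (k + 3)) (Fin.succ 0).succ = 1 - a - b := rfl

theorem tripleDist_succ_succ_succ (j : Fin k) :
    (tripleDist a b h0 h1 h2 : Simplex (k + 3)) j.succ.succ.succ = 0 := rfl

theorem tripleDist_ne {a' b' : ℝ} (h0' : 0 ≤ a') (h1' : 0 ≤ b') (h2' : a' + b' ≤ 1)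
    (h : a ≠ a') : (tripleDist a b h0 h1 h2 : Simplex (k + 3)) ≠ tripleDist a' b' h0' h1' h2' :=
  fun he => h (congrArg (fun x : Simplex (k + 3) => x 0) he)

end TripleDist

/-- The blocks fix the first median at `1/2`, while the manipulator's own scores are the medians for
the next two candidates. Reporting `(0, 1/2, 1/2)` equalizes all three and yields her uniform ideal;
the truth gives `(1/2, 1/3, 1/3)` with sum `7/6`. -/
theorem not_strategyproofFor_med_odd {k h : ℕ} (hh : 1 ≤ h) :
    ¬ StrategyproofFor (med (k + 3)) (h + h + 1) := by
  have key : ∀ (a b c p q : ℝ) (h0 : 0 ≤ a) (h1 : 0 ≤ b) (h2 : a + b ≤ 1) (hp : 0 ≤ p)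
      (hq : 0 ≤ q) (hpq : p + q ≤ 1), c ≠ 0 → b ≤ 1 / 2 → 1 - a - b ≤ 1 / 2 →
      1 / 2 = c * p → b = c * q → 1 - a - b = c * (1 - p - q) → med (k + 3) (h + h + 1)
      (Fin.cons (tripleDist a b h0 h1 h2) (blocks h h
        (tripleDist (1 / 2) (1 / 2) (by norm_num) (by norm_num) (by norm_num))
        (tripleDist (1 / 2) 0 (by norm_num) (by norm_num) (by norm_num))) :
          Profile (h + h + 1) (k + 3)) = tripleDist p q hp hq hpq := by
    intro a b c p q h0 h1 h2 hp hq hpq hc hb hab e0 e1 e2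
    refine med_eq hc fun j => ?_
    rw [scores_cons, scores_blocks]
    refine Fin.cases ?_ (Fin.cases ?_ (Fin.cases ?_ fun j => ?_)) j
    · simp only [tripleDist_zero]
      rw [median_cons_blocks_const hh, e0]
    · simp only [tripleDist_one]
      rw [median_cons_blocks_odd hb h1, e1]
    · simp only [tripleDist_two]
      rw [add_comm, median_cons_blocks_odd (by linarith) (by linarith), e2]
    · simp only [tripleDist_succ_succ_succ]
      rw [median_cons_blocks_odd le_rfl le_rfl, mul_zero]
  refine not_strategyproofFor_of_cons _
    (tripleDist (1 / 3) (1 / 3) (by norm_num) (by norm_num) (by norm_num))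
    (tripleDist 0 (1 / 2) (by norm_num) (by norm_num) (by norm_num))
    (key _ _ (3 / 2) _ _ _ _ _ _ _ _ ?_ ?_ ?_ ?_ ?_ ?_)
    ((key _ _ (7 / 6) (3 / 7) (2 / 7) _ _ _ (by norm_num) (by norm_num) (by norm_num)
      ?_ ?_ ?_ ?_ ?_ ?_).trans_ne (tripleDist_ne _ _ _ _ _ _ ?_))
  all_goals norm_num

theorem not_participationFor_med (k : ℕ) : ¬ ParticipationFor (med (k + 3)) 5 := by
  intro hP
  let A : Simplex (k + 3) := tripleDist (3 / 5) (1 / 5) (by norm_num) (by norm_num) (by norm_num)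
  let B : Simplex (k + 3) := tripleDist (1 / 5) (3 / 5) (by norm_num) (by norm_num) (by norm_num)
  let C : Simplex (k + 3) := tripleDist (1 / 5) (1 / 5) (by norm_num) (by norm_num) (by norm_num)
  let s : Simplex (k + 3) := tripleDist (1 / 3) (1 / 3) (by norm_num) (by norm_num) (by norm_num)
  -- All three medians of `R` are `1/5`, so the outcome is `s`. Adding `s` lifts only the second and
  -- third medians, to `(1/3 + 1/5) / 2 = 4/15`, because there two scores of `3/5` make `1/3` a
  -- middle entry; the total becomes `11/15`.
  let R : Profile 5 (k + 3) := (Fin.cons A (blocks 2 2 B C) : Profile 5 (k + 3))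
  have hR : ∀ j, scores R j =
      A j ::ₘ (Multiset.replicate 2 (B j) + Multiset.replicate 2 (C j)) := fun j => by
    rw [← scores_blocks]
    exact scores_cons A (blocks 2 2 B C) j
  have h1 : med (k + 3) 5 R = s := by
    refine med_eq (c := 3 / 5) (by norm_num) fun j => ?_
    rw [hR]
    refine Fin.cases ?_ (Fin.cases ?_ (Fin.cases ?_ fun j => ?_)) j
    · simp only [A, B, C, s, tripleDist_zero]
      rw [median_cons_blocks_const (by norm_num)]
      norm_num
    · simp only [A, B, C, s, tripleDist_one]
      rw [median_cons_blocks_odd (by norm_num) (by norm_num)]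
      norm_num
    · simp only [A, B, C, s, tripleDist_two]
      rw [add_comm, median_cons_blocks_odd (by norm_num) (by norm_num)]
      norm_num
    · simp only [A, B, C, s, tripleDist_succ_succ_succ]
      rw [median_cons_blocks_odd le_rfl le_rfl, mul_zero]
  have h2 : med (k + 3) 6 (Fin.cons s R : Profile 6 (k + 3)) =
      tripleDist (3 / 11) (4 / 11) (by norm_num) (by norm_num) (by norm_num) := by
    refine med_eq (c := 11 / 15) (by norm_num) fun j => ?_
    rw [scores_cons, hR, median_of_card_even (h := 2) (by simp)]
    have key : ∀ {M : Multiset ℝ} (a b : ℝ) {c : ℝ}, M.countP (a < ·) ≤ 2 → 2 < M.countP (a ≤ ·) →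
        M.countP (b < ·) ≤ 3 → 3 < M.countP (b ≤ ·) → (a + b) / 2 = c →
        (nthLargest M 2 + nthLargest M (2 + 1)) / 2 = c := by
      intro M a b c h1 h2 h3 h4 h5
      rw [nthLargest_eq h1 h2, nthLargest_eq h3 h4, h5]
    refine Fin.cases ?_ (Fin.cases ?_ (Fin.cases ?_ fun j => ?_)) j
    · simp only [A, B, C, s, tripleDist_zero]
      refine key (1 / 5) (1 / 5) ?_ ?_ ?_ ?_ (by norm_num) <;>
        simp only [Multiset.countP_cons, Multiset.countP_add, countP_replicate] <;> norm_num
    · simp only [A, B, C, s, tripleDist_one]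
      refine key (1 / 3) (1 / 5) ?_ ?_ ?_ ?_ (by norm_num) <;>
        simp only [Multiset.countP_cons, Multiset.countP_add, countP_replicate] <;> norm_num
    · simp only [A, B, C, s, tripleDist_two]
      refine key (1 / 3) (1 / 5) ?_ ?_ ?_ ?_ (by norm_num) <;>
        simp only [Multiset.countP_cons, Multiset.countP_add, countP_replicate] <;> norm_num
    · simp only [A, B, C, s, tripleDist_succ_succ_succ]
      refine key 0 0 ?_ ?_ ?_ ?_ (by norm_num) <;>
        simp only [Multiset.countP_cons, Multiset.countP_add, countP_replicate] <;> norm_num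
  have h3 := hP (Fin.cons s R) 0
  have h4 : (fun k' => (Fin.cons s R : Profile 6 (k + 3)) ((0 : Fin 6).succAbove k')) = R := rfl
  rw [h4, h1, h2, Fin.cons_zero, disutility_self] at h3
  exact tripleDist_ne _ _ _ _ _ _ (by norm_num) (eq_of_disutility_le_zero h3)

theorem strategyproofFor_med_iff {m n : ℕ} [NeZero m] (hm : 2 ≤ m) (hn : 2 ≤ n) :
    StrategyproofFor (med m) n ↔ m = 2 ∧ Odd n := by
  constructor
  · intro h
    rcases Nat.even_or_odd' n with ⟨l, rfl | rfl⟩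
    · obtain ⟨k, rfl⟩ : ∃ k, m = k + 2 := ⟨m - 2, by omega⟩
      obtain ⟨l, rfl⟩ : ∃ k, l = k + 1 := ⟨l - 1, by omega⟩
      rw [show 2 * (l + 1) = l + 1 + l + 1 by ring] at h
      exact absurd h not_strategyproofFor_med_even
    · refine ⟨?_, odd_two_mul_add_one l⟩
      by_contra hm'
      obtain ⟨k, rfl⟩ : ∃ k, m = k + 3 := ⟨m - 3, by omega⟩
      rw [show 2 * l + 1 = l + l + 1 by ring] at h
      exact not_strategyproofFor_med_odd (by omega) h
  · rintro ⟨rfl, h⟩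
    exact strategyproofFor_med_two h

end Portioning

theorem mainTheorem5 (m : ℕ) [NeZero m] (hm : 2 ≤ m) :
    -- independent markets and utilitarian rule
    (Strategyproof (im m) ∧ Participation (im m)) ∧
    (Strategyproof (util m) ∧
      Participation (util m)) ∧
    -- average, maximum, minimum, geometric mean and egalitarian rule
    ((∀ n, 2 ≤ n → ¬ StrategyproofFor (avg m) n) ∧
      Participation (avg m)) ∧
    ((∀ n, 2 ≤ n → ¬ StrategyproofFor (maxRule m) n) ∧
      Participation (maxRule m)) ∧
    ((∀ n, 2 ≤ n → ¬ StrategyproofFor (minRule m) n) ∧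
      Participation (minRule m)) ∧
    ((∀ n, 2 ≤ n → ¬ StrategyproofFor (geo m) n) ∧
      Participation (geo m)) ∧
    (∀ F : AggregationRule m, IsEgalRule F →
      (∀ n, 2 ≤ n → ¬ StrategyproofFor F n) ∧ Participation F) ∧
    -- median rule
    (∀ n, 2 ≤ n → (StrategyproofFor (med m) n ↔ m = 2 ∧ Odd n)) ∧
    (m = 2 → Participation (med m)) ∧
    (3 ≤ m → ∃ n, 2 ≤ n ∧ ¬ ParticipationFor (med m) n) := by
  have reduce : ∀ {p : ℕ → Prop}, (∀ n, 1 ≤ n → p (n + 1)) → ∀ n, 2 ≤ n → p n := by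
    rintro p h (_ | n) hn
    · omega
    · exact h n (by omega)
  obtain ⟨k, rfl⟩ : ∃ k, m = k + 2 := ⟨m - 2, by omega⟩
  refine ⟨⟨strategyproof_im _, participation_im _ hm⟩,
    ⟨strategyproof_util _, participation_util _⟩,
    ⟨reduce fun n hn => not_strategyproofFor_avg hn, participation_avg _⟩,
    ⟨reduce fun n hn => not_strategyproofFor_maxRule hn, participation_maxRule _⟩,
    ⟨reduce fun n hn => not_strategyproofFor_minRule hn, participation_minRule _⟩,
    ⟨reduce fun n hn => not_strategyproofFor_geo hn, participation_geo _⟩,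
    fun F hF => ⟨reduce fun n hn => not_strategyproofFor_of_isEgalRule hn hF,
      participation_of_isEgalRule hF⟩,
    fun n hn => strategyproofFor_med_iff hm hn, fun h => ?_, fun h => ⟨5, by norm_num, ?_⟩⟩
  · obtain rfl : k = 0 := by omega
    exact participation_med_two
  · obtain ⟨l, rfl⟩ : ∃ l, k = l + 1 := ⟨k - 1, by omega⟩
    exact not_participationFor_med l
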